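/- Let $0<\alpha<1$, $\kappa>0$ and $\delta>0$. There are constants $c_0,c_1,c_2,c_3>0$, depending only on $\kappa,\delta,\alpha$, for which the following holds. Let $\xi$ be a symmetric real random variable with variance $1$ satisfying $\Pr(|\xi|\ge\kappa)\ge\delta$, let $n\ge 1$ and $N\ge c_1 n$ be integers, let $\Gamma$ be an $N\times n$ random matrix whose entries are independent copies of $\xi$, and let $X_1,\dots,X_N$ be the rows of $\Gamma$. Put $$L=B_\infty^n\cap\sqrt{\log(eN/n)}\,B_2^n,\qquad L^\circ=\{z\in\mathbb R^n:\ |\langle x,z\rangle|\le 1\ \text{ for all } x\in L\},$$ where $B_\infty^n=[-1,1]^n$ and $B_2^n$ is the Euclidean unit ball. Then, with probability at least $1-2\exp(-c_2N^{1-\alpha}n^{\alpha})$, both of the following hold: $$c_3L\subset\mathrm{absconv}(X_1,\dots,X_N),$$ where $\mathrm{absconv}$ denotes the absolute convex hull, and, for every $z$ in the boundary $\partial L^\circ$, $$\bigl|\{i\in\{1,\dots,N\}:\ |\langle z,X_i\rangle|\ge c_0\}\bigr|\ \ge\ N^{1-\alpha}n^{\alpha}.$$ -/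

import Mathlib

open MeasureTheory ProbabilityTheory
open scoped Pointwise

namespace RandomPolytope

/-- A real random variable is symmetric if it has the same distribution as its negative. -/
def IsSymmetric {Ω : Type*} [MeasurableSpace Ω] (ξ : Ω → ℝ) (P : Measure Ω) : Prop :=
  IdentDistrib ξ (fun ω => -ξ ω) P P

/-- The small-ball condition `Pr(|ξ| ≥ κ) ≥ δ`. -/
def SmallBall {Ω : Type*} [MeasurableSpace Ω] (ξ : Ω → ℝ) (P : Measure Ω) (κ δ : ℝ) : Prop :=
  δ ≤ P.real {ω | κ ≤ |ξ ω|}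

/-- `Γ` is a random `N × n` matrix whose entries are independent copies of `ξ`. -/
structure HasIIDEntries {Ω Ω' : Type*} [MeasurableSpace Ω] [MeasurableSpace Ω'] {N n : ℕ}
    (Γ : Ω → Matrix (Fin N) (Fin n) ℝ) (P : Measure Ω) (ξ : Ω' → ℝ) (P' : Measure Ω') :
    Prop where
  indep : iIndepFun (fun (p : Fin N × Fin n) (ω : Ω) => Γ ω p.1 p.2) P
  identDistrib : ∀ i j, IdentDistrib (fun ω => Γ ω i j) ξ P P'

/-- The `i`-th row of a matrix, as a vector of the Euclidean space `ℝⁿ`. -/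
def rowVec {N n : ℕ} (A : Matrix (Fin N) (Fin n) ℝ) (i : Fin N) : EuclideanSpace ℝ (Fin n) :=
  WithLp.toLp 2 (A i)

/-- The unit cube `B_∞ⁿ = [-1, 1]ⁿ`. -/
def cube (n : ℕ) : Set (EuclideanSpace ℝ (Fin n)) :=
  {x | ∀ j, |x j| ≤ 1}

/-- The Euclidean unit ball `B_2ⁿ`. -/
def euclideanBall (n : ℕ) : Set (EuclideanSpace ℝ (Fin n)) :=
  Metric.closedBall 0 1

/-- The convex body `L = B_∞ⁿ ∩ √(log (e N / n)) B_2ⁿ`. -/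
noncomputable def body (N n : ℕ) : Set (EuclideanSpace ℝ (Fin n)) :=
  cube n ∩ √(Real.log (Real.exp 1 * N / n)) • euclideanBall n

/-- The dual (polar) body of `L`. The polar taken here is the absolute one,
`{z | ∀ x ∈ L, |⟪x, z⟫| ≤ 1}`, which is the usual polar since `L = -L`. -/
noncomputable def dualBody (N n : ℕ) : Set (EuclideanSpace ℝ (Fin n)) :=
  (innerₗ (EuclideanSpace ℝ (Fin n))).polar (body N n)

end RandomPolytope

/-! ### Tilting a symmetric law on the line. -/

namespace RandomPolytope

/-! By duality both conclusions reduce to one uniform count: for every `z` with `‖z‖ ≤ 1` and `⟪v,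
z⟫ ≥ 1/2` for some `v ∈ L`, at least `N u` rows satisfy `|⟪z, X_i⟫| ≥ c`, where `u = (n/N)^α`.

For a single vector `y`, reweight the law of a row by `∏ (1 + η v_j φ(x_j))`, with `φ` the odd
truncated sign. This moves the mean of `⟪y, x⟫` to order `η κ δ ⟪v, y⟫` without raising its
variance, so Paley–Zygmund applies under the new law. Returning to the old law by Cauchy–Schwarz
costs `exp (-η² ‖v‖²)`, at worst `(n/(eN))^(η²)`. With `η² = α/2` this beats `4u` once `N/n` is
large (`le_measureReal_sum`, `exists_aspect_ratio`).

Uniformity comes from Chernoff bounds and a union over a lattice net. As `ξ` has only two moments,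
the operator norm of `Γ` is not controlled. Instead `z` is rounded to the lattice in a way that
depends on `Γ`, so that the total squared error over the rows of moderate length is small; few rows
are then spoiled, and few rows are long (`exists_lattice_rounding`, `exists_bad_set`). -/

/-- A symmetric law on the line with unit second moment that satisfies a small-ball condition. -/
structure IsSymmUnitLaw (μ : Measure ℝ) (κ δ : ℝ) : Prop where
  map_neg : μ.map (fun x => -x) = μ
  integrable_sq : Integrable (fun x : ℝ => x ^ 2) μ
  integral_sq : ∫ x, x ^ 2 ∂μ = 1
  smallBall : δ ≤ μ.real {x | κ ≤ |x|}

/-- The sign of `x`, truncated to zero when `|x| < κ`. -/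
noncomputable def truncSign (κ x : ℝ) : ℝ := if κ ≤ x then 1 else if x ≤ -κ then -1 else 0

lemma measurable_truncSign (κ : ℝ) : Measurable (truncSign κ) :=
  Measurable.ite measurableSet_Ici measurable_const
    (Measurable.ite measurableSet_Iic measurable_const measurable_const)

lemma abs_truncSign_le (κ x : ℝ) : |truncSign κ x| ≤ 1 := by
  unfold truncSign; split_ifs <;> simp

lemma truncSign_neg {κ : ℝ} (hκ : 0 < κ) (x : ℝ) : truncSign κ (-x) = -truncSign κ x := by
  unfold truncSign
  split_ifs <;> first | (exfalso; linarith) | simp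

lemma le_truncSign_mul {κ : ℝ} (hκ : 0 < κ) (x : ℝ) :
    Set.indicator {x : ℝ | κ ≤ |x|} (fun _ => κ) x ≤ truncSign κ x * x := by
  unfold truncSign
  simp only [Set.indicator_apply, Set.mem_ofPred_eq, le_abs]
  split_ifs <;> first | linarith | (exfalso; rename_i h _ _; rcases h with h | h <;> linarith)

/-- Integrability is not needed: a non-integrable function has integral `0` by convention. -/
lemma integral_odd {μ : Measure ℝ} (h : μ.map (fun x => -x) = μ) {f : ℝ → ℝ}
    (hf : ∀ x, f (-x) = -f x) : ∫ x, f x ∂μ = 0 := by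
  have h1 : ∫ x, f x ∂μ = ∫ x, f (-x) ∂μ := by
    conv_lhs => rw [← h]
    exact (MeasurableEquiv.neg ℝ).measurableEmbedding.integral_map f
  simp only [hf, integral_neg] at h1
  linarith

variable {μ : Measure ℝ} {κ δ : ℝ}

lemma truncSign_bdd_mul_integrable (c : ℝ) {f : ℝ → ℝ} (hf : Integrable f μ) :
    Integrable (fun x => (1 + c * truncSign κ x) * f x) μ := by
  refine hf.bdd_mul (c := 1 + |c|) ?_ (Filter.Eventually.of_forall fun x => ?_)
  · exact ((measurable_truncSign κ).const_mul c |>.const_add 1).aestronglyMeasurable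
  · calc ‖1 + c * truncSign κ x‖ ≤ ‖(1 : ℝ)‖ + ‖c * truncSign κ x‖ := norm_add_le _ _
      _ ≤ 1 + |c| := by
        rw [norm_mul, Real.norm_eq_abs, Real.norm_eq_abs, Real.norm_eq_abs, abs_one]
        have := mul_le_mul_of_nonneg_left (abs_truncSign_le κ x) (abs_nonneg c)
        linarith

lemma truncSign_mul_integrable {f : ℝ → ℝ} (hf : Integrable f μ) :
    Integrable (fun x => truncSign κ x * f x) μ :=
  hf.bdd_mul (c := 1) (measurable_truncSign κ).aestronglyMeasurable
    (Filter.Eventually.of_forall fun x => abs_truncSign_le κ x)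

lemma integral_tilt_mul (c : ℝ) {f : ℝ → ℝ} (hf : Integrable f μ) :
    ∫ x, (1 + c * truncSign κ x) * f x ∂μ = ∫ x, f x ∂μ + c * ∫ x, truncSign κ x * f x ∂μ := by
  rw [← integral_const_mul, ← integral_add hf ((truncSign_mul_integrable hf).const_mul c)]
  congr 1; ext x; ring

/-- The perturbation `c φ` is odd, so even moments do not feel the tilt. -/
lemma IsSymmUnitLaw.integral_tilt_mul_sq (h : IsSymmUnitLaw μ κ δ) (hκ : 0 < κ) (c : ℝ) :
    ∫ x, (1 + c * truncSign κ x) * x ^ 2 ∂μ = 1 := by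
  rw [integral_tilt_mul c h.integrable_sq, h.integral_sq,
    integral_odd h.map_neg (f := fun x => truncSign κ x * x ^ 2)]
  · simp
  · intro x; rw [truncSign_neg hκ]; ring

variable [IsProbabilityMeasure μ]

lemma IsSymmUnitLaw.integrable_id (h : IsSymmUnitLaw μ κ δ) : Integrable (fun x : ℝ => x) μ := by
  have : MemLp (fun x : ℝ => x) 2 μ :=
    (memLp_two_iff_integrable_sq (by fun_prop)).2 h.integrable_sq
  exact this.integrable (by norm_num)

lemma IsSymmUnitLaw.integral_tilt (h : IsSymmUnitLaw μ κ δ) (hκ : 0 < κ) (c : ℝ) :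
    ∫ x, (1 + c * truncSign κ x) ∂μ = 1 := by
  have := integral_tilt_mul (μ := μ) (κ := κ) c (integrable_const (1 : ℝ))
  simp only [mul_one] at this
  rw [this, integral_odd h.map_neg (truncSign_neg hκ)]
  simp

lemma IsSymmUnitLaw.integral_tilt_mul_id (h : IsSymmUnitLaw μ κ δ) (c : ℝ) :
    ∫ x, (1 + c * truncSign κ x) * x ∂μ = c * ∫ x, truncSign κ x * x ∂μ := by
  rw [integral_tilt_mul c h.integrable_id, integral_odd h.map_neg (f := fun x => x) (fun _ => rfl), zero_add]

lemma IsSymmUnitLaw.integral_tilt_sq_le (h : IsSymmUnitLaw μ κ δ) (hκ : 0 < κ) (c : ℝ) :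
    ∫ x, (1 + c * truncSign κ x) ^ 2 ∂μ ≤ 1 + c ^ 2 := by
  have hi : Integrable (fun x => 1 + c * truncSign κ x) μ := by
    simpa using truncSign_bdd_mul_integrable (μ := μ) (κ := κ) c (integrable_const (1 : ℝ))
  have hj : Integrable (fun x => truncSign κ x * (1 + c * truncSign κ x)) μ :=
    truncSign_mul_integrable hi
  have hj' : Integrable (fun x => truncSign κ x * truncSign κ x) μ := by
    refine truncSign_mul_integrable ?_
    simpa using truncSign_mul_integrable (μ := μ) (κ := κ) (integrable_const (1 : ℝ))
  have hs : Integrable (truncSign κ) μ := by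
    simpa using truncSign_mul_integrable (μ := μ) (κ := κ) (integrable_const (1 : ℝ))
  have h1 : ∫ x, truncSign κ x * (1 + c * truncSign κ x) ∂μ
      = c * ∫ x, truncSign κ x * truncSign κ x ∂μ := by
    have := integral_tilt_mul (μ := μ) (κ := κ) c hs
    rw [integral_odd h.map_neg (truncSign_neg hκ), zero_add] at this
    rw [← this]; congr 1; ext x; ring
  have h2 : ∫ x, truncSign κ x * truncSign κ x ∂μ ≤ 1 := by
    calc _ ≤ ∫ x, (1 : ℝ) ∂μ := integral_mono hj' (integrable_const _) fun x => by
            have := abs_truncSign_le κ x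
            rw [← pow_two]; exact (sq_le_one_iff_abs_le_one _).2 this
      _ = 1 := by simp
  simp_rw [pow_two (1 + c * truncSign κ _)]
  rw [integral_tilt_mul c hi, h.integral_tilt hκ, h1]
  nlinarith [sq_nonneg c]

/-- The small-ball condition enters here: it makes the tilt shift the mean by a definite amount. -/
lemma IsSymmUnitLaw.le_integral_truncSign_mul (h : IsSymmUnitLaw μ κ δ) (hκ : 0 < κ) :
    κ * δ ≤ ∫ x, truncSign κ x * x ∂μ := by
  have hm : MeasurableSet {x : ℝ | κ ≤ |x|} := measurableSet_le measurable_const (by fun_prop)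
  calc κ * δ ≤ ∫ x, Set.indicator {x : ℝ | κ ≤ |x|} (fun _ => κ) x ∂μ := by
        rw [integral_indicator_const _ hm, smul_eq_mul, mul_comm]
        exact mul_le_mul_of_nonneg_right h.smallBall hκ.le
    _ ≤ _ := integral_mono ((integrable_const κ).indicator hm)
        (truncSign_mul_integrable h.integrable_id) (le_truncSign_mul hκ)

end RandomPolytope

/-! ### Product tilts and the tail bound for one vector. -/

namespace RandomPolytope

variable {μ : Measure ℝ} [IsProbabilityMeasure μ] {κ δ : ℝ} {n : ℕ}

/-- The product density `∏ (1 + c_j φ(x_j))`, where `φ` is the truncated sign. -/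
noncomputable def tilt (κ : ℝ) (c x : Fin n → ℝ) : ℝ := ∏ j, (1 + c j * truncSign κ (x j))

lemma tilt_nonneg {c : Fin n → ℝ} (hc : ∀ j, |c j| ≤ 1) (x : Fin n → ℝ) : 0 ≤ tilt κ c x := by
  refine Finset.prod_nonneg fun j _ => ?_
  have : |c j * truncSign κ (x j)| ≤ 1 := by
    rw [abs_mul]
    exact mul_le_one₀ (hc j) (abs_nonneg _) (abs_truncSign_le κ _)
  linarith [neg_le_of_abs_le this]

lemma integral_tilt_mul_prod (c : Fin n → ℝ) (f : Fin n → ℝ → ℝ) :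
    ∫ x, tilt κ c x * ∏ i, f i (x i) ∂(Measure.pi fun _ => μ)
      = ∏ i, ∫ y, (1 + c i * truncSign κ y) * f i y ∂μ := by
  rw [← integral_fintype_prod_eq_prod (fun i y => (1 + c i * truncSign κ y) * f i y)]
  simp only [tilt, Finset.prod_mul_distrib]

lemma integrable_tilt_mul_prod (c : Fin n → ℝ) {f : Fin n → ℝ → ℝ}
    (hf : ∀ i, Integrable (f i) μ) :
    Integrable (fun x => tilt κ c x * ∏ i, f i (x i)) (Measure.pi fun _ => μ) := by
  have := Integrable.fintype_prod (μ := fun _ : Fin n => μ)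
    (fun i => truncSign_bdd_mul_integrable (κ := κ) (c i) (hf i))
  simpa only [tilt, Finset.prod_mul_distrib] using this

/-- Presents a coordinate as a product over all coordinates, so that `integral_tilt_mul_prod`
computes mixed moments. -/
lemma prod_ite_eval (j : Fin n) (x : Fin n → ℝ) :
    ∏ i, (if i = j then x i else 1) = x j := by
  simp

namespace IsSymmUnitLaw

lemma integrable_ite (h : IsSymmUnitLaw μ κ δ) (j i : Fin n) :
    Integrable (fun y : ℝ => if i = j then y else 1) μ := by
  split_ifs
  · exact h.integrable_id
  · exact integrable_const 1

lemma integrable_ite_mul_ite (h : IsSymmUnitLaw μ κ δ) (j k i : Fin n) :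
    Integrable (fun y : ℝ => (if i = j then y else 1) * (if i = k then y else 1)) μ := by
  split_ifs
  · simpa only [pow_two] using h.integrable_sq
  · simpa using h.integrable_id
  · simpa using h.integrable_id
  · simp

lemma integrable_tilt_pi (c : Fin n → ℝ) :
    Integrable (tilt κ c) (Measure.pi fun _ => μ) := by
  simpa using integrable_tilt_mul_prod (μ := μ) (κ := κ) c (f := fun _ _ => 1)
    (fun _ => integrable_const 1)

lemma integral_tilt_pi (h : IsSymmUnitLaw μ κ δ) (hκ : 0 < κ) (c : Fin n → ℝ) :
    ∫ x, tilt κ c x ∂(Measure.pi fun _ => μ) = 1 := by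
  have := integral_tilt_mul_prod (μ := μ) (κ := κ) c (fun _ _ => 1)
  simpa [h.integral_tilt hκ] using this

lemma integrable_tilt_mul_eval (h : IsSymmUnitLaw μ κ δ) (c : Fin n → ℝ) (j : Fin n) :
    Integrable (fun x => tilt κ c x * x j) (Measure.pi fun _ => μ) := by
  simpa only [prod_ite_eval] using
    integrable_tilt_mul_prod (μ := μ) (κ := κ) c (fun i => h.integrable_ite j i)

lemma integral_tilt_mul_eval (h : IsSymmUnitLaw μ κ δ) (hκ : 0 < κ) (c : Fin n → ℝ) (j : Fin n) :
    ∫ x, tilt κ c x * x j ∂(Measure.pi fun _ => μ) = c j * ∫ y, truncSign κ y * y ∂μ := by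
  have := integral_tilt_mul_prod (μ := μ) (κ := κ) c (fun i y => if i = j then y else 1)
  simp only [prod_ite_eval] at this
  rw [this, Finset.prod_eq_single j]
  · simpa using h.integral_tilt_mul_id (c j)
  · intro i _ hij
    simpa [hij] using h.integral_tilt hκ (c i)
  · simp

lemma integrable_tilt_mul_eval_mul_eval (h : IsSymmUnitLaw μ κ δ) (c : Fin n → ℝ) (j k : Fin n) :
    Integrable (fun x => tilt κ c x * (x j * x k)) (Measure.pi fun _ => μ) := by
  simpa only [Finset.prod_mul_distrib, prod_ite_eval] using
    integrable_tilt_mul_prod (μ := μ) (κ := κ) c (fun i => h.integrable_ite_mul_ite j k i)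

lemma integral_tilt_mul_eval_mul_eval (h : IsSymmUnitLaw μ κ δ) (hκ : 0 < κ) (c : Fin n → ℝ)
    {j k : Fin n} (hjk : j ≠ k) :
    ∫ x, tilt κ c x * (x j * x k) ∂(Measure.pi fun _ => μ)
      = (c j * ∫ y, truncSign κ y * y ∂μ) * (c k * ∫ y, truncSign κ y * y ∂μ) := by
  have := integral_tilt_mul_prod (μ := μ) (κ := κ) c
    (fun i y => (if i = j then y else 1) * (if i = k then y else 1))
  simp only [Finset.prod_mul_distrib, prod_ite_eval] at this
  rw [this, ← prod_ite_eval j (fun j => c j * ∫ y, truncSign κ y * y ∂μ),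
    ← prod_ite_eval k (fun j => c j * ∫ y, truncSign κ y * y ∂μ), ← Finset.prod_mul_distrib]
  refine Finset.prod_congr rfl fun i _ => ?_
  by_cases hj : i = j
  · have hk : i ≠ k := hj ▸ hjk
    simpa [hj, hk, hjk] using h.integral_tilt_mul_id (c j)
  · by_cases hk : i = k
    · simpa [hj, hk, hjk.symm] using h.integral_tilt_mul_id (c k)
    · simpa [hj, hk] using h.integral_tilt hκ (c i)

lemma integral_tilt_mul_eval_sq (h : IsSymmUnitLaw μ κ δ) (hκ : 0 < κ) (c : Fin n → ℝ)
    (j : Fin n) :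
    ∫ x, tilt κ c x * (x j * x j) ∂(Measure.pi fun _ => μ) = 1 := by
  have := integral_tilt_mul_prod (μ := μ) (κ := κ) c
    (fun i y => (if i = j then y else 1) * (if i = j then y else 1))
  simp only [Finset.prod_mul_distrib, prod_ite_eval] at this
  rw [this]
  refine Finset.prod_eq_one fun i _ => ?_
  by_cases hj : i = j
  · simpa [hj, pow_two] using h.integral_tilt_mul_sq hκ (c j)
  · simpa [hj] using h.integral_tilt hκ (c i)

lemma integrable_tilt_mul_sum (h : IsSymmUnitLaw μ κ δ) (c a : Fin n → ℝ) :
    Integrable (fun x => tilt κ c x * ∑ j, a j * x j) (Measure.pi fun _ => μ) := by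
  have : Integrable (fun x => ∑ j, a j * (tilt κ c x * x j)) (Measure.pi fun _ => μ) :=
    integrable_finsetSum _ fun j _ => (h.integrable_tilt_mul_eval c j).const_mul (a j)
  refine this.congr (Filter.Eventually.of_forall fun x => ?_)
  simp only [Finset.mul_sum]
  exact Finset.sum_congr rfl fun j _ => by ring

lemma integral_tilt_mul_sum (h : IsSymmUnitLaw μ κ δ) (hκ : 0 < κ) (c a : Fin n → ℝ) :
    ∫ x, tilt κ c x * ∑ j, a j * x j ∂(Measure.pi fun _ => μ)
      = ∑ j, a j * (c j * ∫ y, truncSign κ y * y ∂μ) := by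
  simp_rw [← h.integral_tilt_mul_eval hκ c, ← integral_const_mul]
  rw [← integral_finsetSum _ fun j _ => (h.integrable_tilt_mul_eval c j).const_mul (a j)]
  congr 1; ext x
  rw [Finset.mul_sum]
  exact Finset.sum_congr rfl fun j _ => by ring

lemma tilt_mul_sum_sq (c a x : Fin n → ℝ) :
    tilt κ c x * (∑ j, a j * x j) ^ 2
      = ∑ j, ∑ k, a j * a k * (tilt κ c x * (x j * x k)) := by
  rw [pow_two, Finset.sum_mul_sum, Finset.mul_sum]
  refine Finset.sum_congr rfl fun j _ => ?_
  rw [Finset.mul_sum]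
  exact Finset.sum_congr rfl fun k _ => by ring

lemma integrable_tilt_mul_sum_sq (h : IsSymmUnitLaw μ κ δ) (c a : Fin n → ℝ) :
    Integrable (fun x => tilt κ c x * (∑ j, a j * x j) ^ 2) (Measure.pi fun _ => μ) := by
  simp_rw [tilt_mul_sum_sq]
  exact integrable_finsetSum _ fun j _ => integrable_finsetSum _ fun k _ =>
    (h.integrable_tilt_mul_eval_mul_eval c j k).const_mul _

lemma integral_tilt_mul_sum_sq_le (h : IsSymmUnitLaw μ κ δ) (hκ : 0 < κ) (c a : Fin n → ℝ) :
    ∫ x, tilt κ c x * (∑ j, a j * x j) ^ 2 ∂(Measure.pi fun _ => μ)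
      ≤ (∑ j, a j * (c j * ∫ y, truncSign κ y * y ∂μ)) ^ 2 + ∑ j, a j ^ 2 := by
  simp_rw [tilt_mul_sum_sq]
  rw [integral_finsetSum _ fun j _ => integrable_finsetSum _ fun k _ =>
    (h.integrable_tilt_mul_eval_mul_eval c j k).const_mul _]
  rw [pow_two, Finset.sum_mul_sum, ← Finset.sum_add_distrib]
  refine Finset.sum_le_sum fun j _ => ?_
  rw [integral_finsetSum _ fun k _ =>
    (h.integrable_tilt_mul_eval_mul_eval c j k).const_mul _]
  simp_rw [integral_const_mul]
  have hone : a j ^ 2 = ∑ k, if k = j then a j ^ 2 else 0 := by simp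
  rw [hone, ← Finset.sum_add_distrib]
  refine Finset.sum_le_sum fun k _ => ?_
  by_cases hjk : k = j
  · subst hjk
    rw [h.integral_tilt_mul_eval_sq hκ]
    simp only [if_true]
    nlinarith [sq_nonneg (a k * (c k * ∫ y, truncSign κ y * y ∂μ))]
  · rw [h.integral_tilt_mul_eval_mul_eval hκ c (Ne.symm hjk)]
    simp only [hjk, if_false]
    linarith

lemma integrable_tilt_sq (c : Fin n → ℝ) :
    Integrable (fun x => tilt κ c x ^ 2) (Measure.pi fun _ => μ) := by
  have := integrable_tilt_mul_prod (μ := μ) (κ := κ) c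
    (f := fun i y => 1 + c i * truncSign κ y) fun i => by
      simpa using truncSign_bdd_mul_integrable (μ := μ) (κ := κ) (c i) (integrable_const (1 : ℝ))
  refine this.congr (Filter.Eventually.of_forall fun x => ?_)
  simp only [pow_two]; rfl

lemma integral_tilt_sq_pi_le (h : IsSymmUnitLaw μ κ δ) (hκ : 0 < κ) (c : Fin n → ℝ) :
    ∫ x, tilt κ c x ^ 2 ∂(Measure.pi fun _ => μ) ≤ Real.exp (∑ j, c j ^ 2) := by
  have := integral_tilt_mul_prod (μ := μ) (κ := κ) c (fun i y => 1 + c i * truncSign κ y)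
  simp only [← pow_two] at this
  have e : ∀ x, tilt κ c x ^ 2 = tilt κ c x * ∏ i, (1 + c i * truncSign κ (x i)) := fun x => by
    rw [pow_two]; rfl
  simp_rw [e, this, Real.exp_sum]
  refine Finset.prod_le_prod (fun i _ => integral_nonneg fun _ => sq_nonneg _) fun i _ => ?_
  exact (h.integral_tilt_sq_le hκ (c i)).trans (by linarith [Real.add_one_le_exp (c i ^ 2)])

/-- A lower bound for the tail of a weighted sum of independent copies of a symmetric variable. -/
lemma le_measureReal_sum (h : IsSymmUnitLaw μ κ δ) (hκ : 0 < κ) {c a : Fin n → ℝ}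
    (hc : ∀ j, |c j| ≤ 1) {M G B : ℝ}
    (hM : ∑ j, a j * (c j * ∫ y, truncSign κ y * y ∂μ) = M) (hM0 : 0 < M)
    (hG : ∑ j, c j ^ 2 ≤ G) (hB : ∑ j, a j ^ 2 ≤ B) :
    (M ^ 2 / (4 * (M ^ 2 + B))) ^ 2 * Real.exp (-G)
      ≤ (Measure.pi fun _ : Fin n => μ).real {x | M / 2 ≤ ∑ j, a j * x j} := by
  set ν := Measure.pi fun _ : Fin n => μ
  set A : Set (Fin n → ℝ) := {x | M / 2 ≤ ∑ j, a j * x j} with hA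
  have hB0 : 0 ≤ B := le_trans (Finset.sum_nonneg fun j _ => sq_nonneg _) hB
  have hAm : MeasurableSet A := measurableSet_le measurable_const (by fun_prop)
  set I : (Fin n → ℝ) → ℝ := A.indicator fun _ => 1 with hI
  have hI01 : ∀ x, I x = 0 ∨ I x = 1 := fun x => by
    by_cases hx : x ∈ A <;> simp [hI, hx]
  have hIi : Integrable I ν := (integrable_const 1).indicator hAm
  have hIint : ∫ x, I x ∂ν = ν.real A := by simp [hI, integral_indicator hAm]
  have hDi := integrable_tilt_pi (μ := μ) (κ := κ) c
  have hDI : Integrable (fun x => tilt κ c x * I x) ν :=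
    hDi.mul_bdd (c := 1) hIi.aestronglyMeasurable (Filter.Eventually.of_forall fun x => by
      rcases hI01 x with h | h <;> simp [h])
  set Q := M ^ 2 + B with hQ
  have hQ0 : 0 < Q := by positivity
  set b := M ^ 2 / (4 * Q) with hb
  have hb0 : 0 < b := by positivity
  -- first Cauchy–Schwarz step, in additive form
  have step1 : b ≤ ∫ x, tilt κ c x * I x ∂ν := by
    have hsum : Integrable (fun x => (M / 2) * tilt κ c x
        + (M / (4 * Q)) * (tilt κ c x * (∑ j, a j * x j) ^ 2)) ν :=
      (hDi.const_mul _).add ((h.integrable_tilt_mul_sum_sq c a).const_mul _)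
    have hmono : ∫ x, tilt κ c x * ∑ j, a j * x j ∂ν ≤
        ∫ x, ((M / 2) * tilt κ c x + (M / (4 * Q)) * (tilt κ c x * (∑ j, a j * x j) ^ 2)
          + (Q / M) * (tilt κ c x * I x)) ∂ν := by
      refine integral_mono (h.integrable_tilt_mul_sum c a)
        (hsum.add (hDI.const_mul _)) fun x => ?_
      set S := ∑ j, a j * x j
      -- Paley–Zygmund pointwise: on `A` by completing the square, off `A` because `S < M / 2`. The
      -- weight `M / (4 * Q)` makes the quadratic term integrate to at most `M / 4`.
      have key : S ≤ M / 2 + M / (4 * Q) * S ^ 2 + Q / M * I x := by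
        by_cases hx : x ∈ A
        · have : I x = 1 := by simp [hI, hx]
          rw [this, mul_one]
          have e : M / (4 * Q) * S ^ 2 + Q / M - S = M / (4 * Q) * (S - 2 * Q / M) ^ 2 := by
            field_simp; ring
          have : 0 ≤ M / (4 * Q) * (S - 2 * Q / M) ^ 2 := by positivity
          linarith
        · have : I x = 0 := by simp [hI, hx]
          rw [this, mul_zero]
          have h1 : S < M / 2 := not_le.1 hx
          have : 0 ≤ M / (4 * Q) * S ^ 2 := by positivity
          linarith
      calc tilt κ c x * S ≤ tilt κ c x * (M / 2 + M / (4 * Q) * S ^ 2 + Q / M * I x) :=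
            mul_le_mul_of_nonneg_left key (tilt_nonneg hc x)
        _ = _ := by ring
    rw [integral_add hsum (hDI.const_mul _), integral_add (hDi.const_mul _)
      ((h.integrable_tilt_mul_sum_sq c a).const_mul _), integral_const_mul, integral_const_mul,
      integral_const_mul, h.integral_tilt_mul_sum hκ, hM, h.integral_tilt_pi hκ] at hmono
    have h2 : ∫ x, tilt κ c x * (∑ j, a j * x j) ^ 2 ∂ν ≤ Q := by
      have := h.integral_tilt_mul_sum_sq_le hκ c a
      rw [hM] at this
      linarith
    have h3 : M / (4 * Q) * ∫ x, tilt κ c x * (∑ j, a j * x j) ^ 2 ∂ν ≤ M / 4 := by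
      calc _ ≤ M / (4 * Q) * Q := mul_le_mul_of_nonneg_left h2 (by positivity)
        _ = M / 4 := by field_simp
    have h4 : M / 4 ≤ Q / M * ∫ x, tilt κ c x * I x ∂ν := by linarith
    calc b = (M / Q) * (M / 4) := by rw [hb]; field_simp
      _ ≤ (M / Q) * (Q / M * ∫ x, tilt κ c x * I x ∂ν) :=
          mul_le_mul_of_nonneg_left h4 (by positivity)
      _ = _ := by field_simp
  -- second Cauchy–Schwarz step
  have hE : 0 < Real.exp (-G) := Real.exp_pos _
  have step2 : ∫ x, tilt κ c x * I x ∂ν ≤ b / 2 + Real.exp G / (2 * b) * ν.real A := by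
    -- Young's inequality, weighted so that the `tilt ^ 2` term integrates to at most `b / 2`, half
    -- of what `step1` provides.
    have hmono : ∫ x, tilt κ c x * I x ∂ν ≤
        ∫ x, (b * Real.exp (-G) / 2 * tilt κ c x ^ 2 + Real.exp G / (2 * b) * I x) ∂ν := by
      refine integral_mono hDI (((integrable_tilt_sq c).const_mul _).add (hIi.const_mul _))
        fun x => ?_
      have hEG : Real.exp G = (Real.exp (-G))⁻¹ := by rw [Real.exp_neg, inv_inv]
      simp only [hEG]
      set E := Real.exp (-G)
      rcases hI01 x with h | h <;> rw [h]
      · rw [mul_zero, mul_zero, add_zero]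
        positivity
      · have e : b * E / 2 * tilt κ c x ^ 2 + E⁻¹ / (2 * b) * 1 - tilt κ c x * 1
            = b * E / 2 * (tilt κ c x - 1 / (b * E)) ^ 2 := by
          field_simp; ring
        have : 0 ≤ b * E / 2 * (tilt κ c x - 1 / (b * E)) ^ 2 := by positivity
        linarith
    rw [integral_add ((integrable_tilt_sq c).const_mul _) (hIi.const_mul _), integral_const_mul,
      integral_const_mul, hIint] at hmono
    have h2 : b * Real.exp (-G) / 2 * ∫ x, tilt κ c x ^ 2 ∂ν ≤ b / 2 := by
      calc _ ≤ b * Real.exp (-G) / 2 * Real.exp G :=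
            mul_le_mul_of_nonneg_left ((h.integral_tilt_sq_pi_le hκ c).trans
              (Real.exp_le_exp.2 hG)) (by positivity)
        _ = b / 2 * (Real.exp (-G) * Real.exp G) := by ring
        _ = b / 2 := by rw [← Real.exp_add]; simp
    linarith
  have h5 : b / 2 ≤ Real.exp G / (2 * b) * ν.real A := by linarith
  calc b ^ 2 * Real.exp (-G) = (2 * b * Real.exp (-G)) * (b / 2) := by ring
    _ ≤ (2 * b * Real.exp (-G)) * (Real.exp G / (2 * b) * ν.real A) :=
        mul_le_mul_of_nonneg_left h5 (by positivity)
    _ = (Real.exp (-G) * Real.exp G) * ν.real A := by field_simp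
    _ = ν.real A := by rw [← Real.exp_add]; simp

end IsSymmUnitLaw
end RandomPolytope

namespace RandomPolytope

/-! ### Chernoff bounds for the number of rows in a set. -/

section Chernoff

variable {E : Type*} {N : ℕ}

lemma ncard_eq_sum_indicator (A : Set E) (x : Fin N → E) :
    ({i | x i ∈ A}.ncard : ℝ) = ∑ i, A.indicator (fun _ => (1 : ℝ)) (x i) := by
  classical
  rw [Set.ncard_eq_toFinset_card']
  simp [Set.indicator_apply]

lemma exp_mul_indicator (A : Set E) (t : ℝ) (y : E) :
    Real.exp (t * A.indicator (fun _ => (1 : ℝ)) y)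
      = 1 + (Real.exp t - 1) * A.indicator (fun _ => (1 : ℝ)) y := by
  by_cases h : y ∈ A <;> simp [h]

lemma exp_mul_ncard (A : Set E) (t : ℝ) (x : Fin N → E) :
    Real.exp (t * ({i | x i ∈ A}.ncard : ℝ))
      = ∏ i, Real.exp (t * A.indicator (fun _ => (1 : ℝ)) (x i)) := by
  rw [ncard_eq_sum_indicator, Finset.mul_sum, Real.exp_sum]

variable [MeasurableSpace E]

lemma measurable_ncard {A : Set E} (hA : MeasurableSet A) :
    Measurable fun x : Fin N → E => ({i | x i ∈ A}.ncard : ℝ) := by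
  simp_rw [ncard_eq_sum_indicator]
  exact Finset.measurable_sum _ fun i _ =>
    (measurable_const.indicator hA).comp (measurable_pi_apply i)

variable {ν : Measure E} [IsProbabilityMeasure ν]

lemma integrable_exp_mul_indicator {A : Set E} (hA : MeasurableSet A) (t : ℝ) :
    Integrable (fun y => Real.exp (t * A.indicator (fun _ => (1 : ℝ)) y)) ν := by
  simp_rw [exp_mul_indicator]
  exact (integrable_const 1).add (((integrable_const 1).indicator hA).const_mul _)

lemma integrable_exp_mul_ncard {A : Set E} (hA : MeasurableSet A) (t : ℝ) :
    Integrable (fun x : Fin N → E => Real.exp (t * ({i | x i ∈ A}.ncard : ℝ)))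
      (Measure.pi fun _ => ν) := by
  simp_rw [exp_mul_ncard]
  exact Integrable.fintype_prod (μ := fun _ : Fin N => ν)
    fun _ => integrable_exp_mul_indicator hA t

lemma mgf_ncard_le {A : Set E} (hA : MeasurableSet A) (t : ℝ) :
    mgf (fun x : Fin N → E => ({i | x i ∈ A}.ncard : ℝ)) (Measure.pi fun _ => ν) t
      ≤ Real.exp (N * ((Real.exp t - 1) * ν.real A)) := by
  have h1 : ∫ y, Real.exp (t * A.indicator (fun _ => (1 : ℝ)) y) ∂ν
      = 1 + (Real.exp t - 1) * ν.real A := by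
    simp_rw [exp_mul_indicator]
    rw [integral_add (integrable_const 1) (((integrable_const 1).indicator hA).const_mul _),
      integral_const_mul, integral_indicator_const _ hA]
    simp
  have h0 : 0 ≤ ∫ y, Real.exp (t * A.indicator (fun _ => (1 : ℝ)) y) ∂ν :=
    integral_nonneg fun _ => (Real.exp_pos _).le
  simp_rw [mgf, exp_mul_ncard]
  rw [integral_fintype_prod_eq_pow (ι := Fin N)
    (fun y => Real.exp (t * A.indicator (fun _ => (1 : ℝ)) y)), Fintype.card_fin, Real.exp_nat_mul]
  refine pow_le_pow_left₀ h0 ?_ N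
  rw [h1, add_comm]
  exact Real.add_one_le_exp _

/-- Chernoff at parameter `-1`; `3 / 5` is a rational lower bound for `1 - 1/e`. -/
lemma measureReal_ncard_le_le {A : Set E} (hA : MeasurableSet A) {p : ℝ} (hp : p ≤ ν.real A)
    (s : ℝ) :
    (Measure.pi fun _ : Fin N => ν).real {x | ({i | x i ∈ A}.ncard : ℝ) ≤ s}
      ≤ Real.exp (s - 3 / 5 * (N * p)) := by
  refine (measure_le_le_exp_mul_mgf (t := -1) s (by norm_num)
    (integrable_exp_mul_ncard hA _)).trans ?_
  refine (mul_le_mul_of_nonneg_left (mgf_ncard_le hA _) (Real.exp_pos _).le).trans ?_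
  rw [← Real.exp_add, Real.exp_le_exp]
  have he : Real.exp (-1) ≤ 2 / 5 := by
    rw [Real.exp_neg, inv_le_comm₀ (Real.exp_pos _) (by norm_num)]
    linarith [Real.exp_one_gt_d9]
  have h1 : 3 / 5 * p ≤ (1 - Real.exp (-1)) * ν.real A :=
    calc 3 / 5 * p ≤ 3 / 5 * ν.real A := by linarith
      _ ≤ _ := mul_le_mul_of_nonneg_right (by linarith) measureReal_nonneg
  have h2 := mul_le_mul_of_nonneg_left h1 (Nat.cast_nonneg (α := ℝ) N)
  linarith

/-- Chernoff at parameter `1`; `2` is an upper bound for `e - 1`. -/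
lemma measureReal_le_ncard_le {A : Set E} (hA : MeasurableSet A) {q : ℝ} (hq : ν.real A ≤ q)
    (s : ℝ) :
    (Measure.pi fun _ : Fin N => ν).real {x | s ≤ ({i | x i ∈ A}.ncard : ℝ)}
      ≤ Real.exp (2 * (N * q) - s) := by
  refine (measure_ge_le_exp_mul_mgf (t := 1) s (by norm_num)
    (integrable_exp_mul_ncard hA _)).trans ?_
  refine (mul_le_mul_of_nonneg_left (mgf_ncard_le hA _) (Real.exp_pos _).le).trans ?_
  rw [← Real.exp_add, Real.exp_le_exp]
  have h1 : (Real.exp 1 - 1) * ν.real A ≤ 2 * q :=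
    calc _ ≤ 2 * ν.real A :=
          mul_le_mul_of_nonneg_right (by linarith [Real.exp_one_lt_d9]) measureReal_nonneg
      _ ≤ _ := by linarith
  have h2 := mul_le_mul_of_nonneg_left h1 (Nat.cast_nonneg (α := ℝ) N)
  linarith

end Chernoff

/-! ### Lattice nets and rounding. -/

section Net

lemma sum_Icc_exp_neg_abs_le (K : ℕ) {l : ℝ} (hl : 0 < l) :
    ∑ k ∈ Finset.Icc (-(K : ℤ)) K, Real.exp (-(l * |(k : ℝ)|)) ≤ 2 / (1 - Real.exp (-l)) := by
  classical
  have hw1 : Real.exp (-l) < 1 := by rw [Real.exp_lt_one_iff]; linarith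
  have hw0 := (Real.exp_pos (-l)).le
  have hgeom : ∑ k ∈ Finset.range (K + 1), Real.exp (-l) ^ k ≤ 1 / (1 - Real.exp (-l)) := by
    rw [one_div, ← tsum_geometric_of_lt_one hw0 hw1]
    exact (summable_geometric_of_lt_one hw0 hw1).sum_le_tsum _ fun _ _ => pow_nonneg hw0 _
  have hterm : ∀ k : ℕ, Real.exp (-(l * (k : ℝ))) = Real.exp (-l) ^ k := fun k => by
    rw [← Real.exp_nat_mul]; ring_nf
  -- Two geometric series, with `0` counted twice; the resulting bound is free of `K`.
  have hsub : Finset.Icc (-(K : ℤ)) K ⊆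
      (Finset.range (K + 1)).image (fun k : ℕ => (k : ℤ)) ∪
        (Finset.range (K + 1)).image (fun k : ℕ => -(k : ℤ)) := by
    intro k hk
    rw [Finset.mem_Icc] at hk
    simp only [Finset.mem_union, Finset.mem_image, Finset.mem_range]
    rcases le_total 0 k with h | h
    · exact Or.inl ⟨k.toNat, by omega, by omega⟩
    · exact Or.inr ⟨(-k).toNat, by omega, by omega⟩
  have hnn : ∀ k : ℤ, 0 ≤ Real.exp (-(l * |(k : ℝ)|)) := fun _ => (Real.exp_pos _).le
  calc _ ≤ ∑ k ∈ (Finset.range (K + 1)).image (fun k : ℕ => (k : ℤ)) ∪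
        (Finset.range (K + 1)).image (fun k : ℕ => -(k : ℤ)), Real.exp (-(l * |(k : ℝ)|)) :=
        Finset.sum_le_sum_of_subset_of_nonneg hsub fun _ _ _ => hnn _
    _ ≤ ∑ k ∈ (Finset.range (K + 1)).image (fun k : ℕ => (k : ℤ)), Real.exp (-(l * |(k : ℝ)|))
        + ∑ k ∈ (Finset.range (K + 1)).image (fun k : ℕ => -(k : ℤ)),
          Real.exp (-(l * |(k : ℝ)|)) := by
        rw [← Finset.sum_union_inter]
        exact le_add_of_nonneg_right (Finset.sum_nonneg fun _ _ => hnn _)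
    _ ≤ 1 / (1 - Real.exp (-l)) + 1 / (1 - Real.exp (-l)) := by
        refine add_le_add ?_ ?_
        · rw [Finset.sum_image (fun a _ b _ h => by simpa using h)]
          simpa [hterm] using hgeom
        · rw [Finset.sum_image (fun a _ b _ h => by simpa using h)]
          simpa [hterm] using hgeom
    _ = _ := by ring

/-- Lattice points of a cross-polytope, counted by an exponential moment. -/
lemma exists_finset_lattice (n : ℕ) (M : ℝ) {l : ℝ} (hl : 0 < l) :
    ∃ F : Finset (Fin n → ℤ), (∀ k : Fin n → ℤ, k ∈ F ↔ ∑ j, |(k j : ℝ)| ≤ M) ∧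
      (F.card : ℝ) ≤ Real.exp (l * M) * (2 / (1 - Real.exp (-l))) ^ n := by
  classical
  set K := ⌈M⌉₊ with hK
  set B := Fintype.piFinset fun _ : Fin n => Finset.Icc (-(K : ℤ)) K with hB
  refine ⟨B.filter fun k => ∑ j, |(k j : ℝ)| ≤ M, fun k => ?_, ?_⟩
  · rw [Finset.mem_filter, and_iff_right_iff_imp]
    intro hk
    rw [hB, Fintype.mem_piFinset]
    intro j
    have h1 : |(k j : ℝ)| ≤ M := le_trans
      (Finset.single_le_sum (f := fun j => |(k j : ℝ)|) (fun _ _ => abs_nonneg _)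
        (Finset.mem_univ j)) hk
    have h2 : |(k j : ℝ)| ≤ (K : ℝ) := h1.trans (Nat.le_ceil M)
    have h3 : |k j| ≤ (K : ℤ) := by exact_mod_cast h2
    rw [Finset.mem_Icc]
    exact abs_le.1 h3
  · have hterm : ∀ k : Fin n → ℤ, ∏ j, Real.exp (-(l * |(k j : ℝ)|))
        = Real.exp (-(l * ∑ j, |(k j : ℝ)|)) := fun k => by
      rw [← Real.exp_sum, Finset.sum_neg_distrib, Finset.mul_sum]
    -- Each counted point has weight `exp (l * (M - ∑ |k j|)) ≥ 1`, and the weights factor over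
    -- coordinates. The box `B` only ensures finiteness.
    have h1 : ((B.filter fun k => ∑ j, |(k j : ℝ)| ≤ M).card : ℝ) ≤
        ∑ k ∈ B, Real.exp (l * M) * ∏ j, Real.exp (-(l * |(k j : ℝ)|)) := by
      calc _ = ∑ k ∈ B.filter (fun k => ∑ j, |(k j : ℝ)| ≤ M), (1 : ℝ) := by simp
        _ ≤ ∑ k ∈ B.filter (fun k => ∑ j, |(k j : ℝ)| ≤ M),
            Real.exp (l * M) * ∏ j, Real.exp (-(l * |(k j : ℝ)|)) := by
          refine Finset.sum_le_sum fun k hk => ?_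
          rw [hterm, ← Real.exp_add]
          refine Real.one_le_exp ?_
          have := mul_le_mul_of_nonneg_left (Finset.mem_filter.1 hk).2 hl.le
          linarith
        _ ≤ _ := Finset.sum_le_sum_of_subset_of_nonneg (Finset.filter_subset _ _)
          fun k _ _ => by rw [hterm]; positivity
    refine h1.trans ?_
    rw [← Finset.mul_sum]
    refine mul_le_mul_of_nonneg_left ?_ (Real.exp_pos _).le
    rw [hB, ← Finset.prod_univ_sum (fun _ : Fin n => Finset.Icc (-(K : ℤ)) K)
      (fun _ k => Real.exp (-(l * |(k : ℝ)|)))]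
    rw [Finset.prod_const, Finset.card_univ, Fintype.card_fin]
    exact pow_le_pow_left₀ (Finset.sum_nonneg fun _ _ => (Real.exp_pos _).le)
      (sum_Icc_exp_neg_abs_le K hl) n

lemma two_div_one_sub_exp_neg_le {r : ℝ} (hr : 0 < r) (hr1 : r ≤ 1) :
    2 / (1 - Real.exp (-(r / 2))) ≤ 8 / r := by
  have h1 : Real.exp (-(r / 2)) ≤ (1 + r / 2)⁻¹ := by
    rw [Real.exp_neg]
    exact inv_anti₀ (by positivity) (by linarith [Real.add_one_le_exp (r / 2)])
  have h2 : (1 + r / 2)⁻¹ ≤ 1 - r / 4 := by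
    rw [inv_le_iff_one_le_mul₀ (by positivity)]
    nlinarith
  calc 2 / (1 - Real.exp (-(r / 2))) ≤ 2 / (r / 4) :=
        div_le_div_of_nonneg_left (by norm_num) (by positivity) (by linarith)
    _ = 8 / r := by field_simp; norm_num

/-- Greedy rounding of a vector to a lattice with small total effect on a family of functionals. -/
lemma exists_lattice_rounding {ι : Type*} (G : Finset ι) {n : ℕ} (X : ι → Fin n → ℝ)
    (z : Fin n → ℝ) {h : ℝ} (hh : 0 < h) :
    ∃ k : Fin n → ℤ, (∀ j, |z j - h * k j| ≤ h) ∧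
      ∑ i ∈ G, (∑ j, X i j * (z j - h * k j)) ^ 2 ≤ h ^ 2 * ∑ j, ∑ i ∈ G, X i j ^ 2 := by
  classical
  have hfl : ∀ j, z j - h * ⌊z j / h⌋ ∈ Set.Icc 0 h := fun j => by
    have h1 := Int.floor_le (z j / h)
    have h2 := (Int.lt_floor_add_one (z j / h)).le
    rw [le_div_iff₀ hh] at h1
    rw [div_le_iff₀ hh] at h2
    constructor <;> linarith
  have hce : ∀ j, z j - h * ⌈z j / h⌉ ∈ Set.Icc (-h) 0 := fun j => by
    have h1 := Int.le_ceil (z j / h)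
    have h2 := (Int.ceil_lt_add_one (z j / h)).le
    rw [div_le_iff₀ hh] at h1
    rw [← sub_le_iff_le_add, le_div_iff₀ hh] at h2
    constructor <;> linarith
  suffices H : ∀ s : Finset (Fin n), ∃ k : Fin n → ℤ, (∀ j, |z j - h * k j| ≤ h) ∧
      ∑ i ∈ G, (∑ j ∈ s, X i j * (z j - h * k j)) ^ 2 ≤ h ^ 2 * ∑ j ∈ s, ∑ i ∈ G, X i j ^ 2 from
    H Finset.univ
  intro s
  induction s using Finset.induction_on with
  | empty =>
    refine ⟨fun j => ⌊z j / h⌋, fun j => ?_, by simp⟩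
    rw [abs_of_nonneg (hfl j).1]
    exact (hfl j).2
  | insert a s ha ih =>
    obtain ⟨k, hk, hs⟩ := ih
    set T : ι → ℝ := fun i => ∑ j ∈ s, X i j * (z j - h * k j) with hT
    -- Rounding down or up gives either sign of the new error, so the cross term with the
    -- accumulated errors `T` can be made nonpositive.
    obtain ⟨b, hb1, hb2⟩ : ∃ b : ℤ, |z a - h * b| ≤ h ∧
        (z a - h * b) * ∑ i ∈ G, T i * X i a ≤ 0 := by
      rcases le_total 0 (∑ i ∈ G, T i * X i a) with hc | hc
      · refine ⟨⌈z a / h⌉, abs_le.2 ⟨(hce a).1, (hce a).2.trans hh.le⟩, ?_⟩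
        exact mul_nonpos_of_nonpos_of_nonneg (hce a).2 hc
      · refine ⟨⌊z a / h⌋, abs_le.2 ⟨by linarith [(hfl a).1], (hfl a).2⟩, ?_⟩
        exact mul_nonpos_of_nonneg_of_nonpos (hfl a).1 hc
    refine ⟨Function.update k a b, fun j => ?_, ?_⟩
    · by_cases hj : j = a
      · subst hj; simpa using hb1
      · simpa [hj] using hk j
    · have hsum : ∀ i, ∑ j ∈ insert a s, X i j * (z j - h * (Function.update k a b j : ℤ))
          = X i a * (z a - h * b) + T i := fun i => by
        rw [Finset.sum_insert ha]
        congr 1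
        · simp
        · refine Finset.sum_congr rfl fun j hj => ?_
          rw [Function.update_of_ne (by rintro rfl; exact ha hj)]
      simp_rw [hsum]
      rw [Finset.sum_insert ha]
      have hexp : ∑ i ∈ G, (X i a * (z a - h * b) + T i) ^ 2
          = (z a - h * b) ^ 2 * ∑ i ∈ G, X i a ^ 2
            + 2 * ((z a - h * b) * ∑ i ∈ G, T i * X i a) + ∑ i ∈ G, T i ^ 2 := by
        simp_rw [Finset.mul_sum]
        rw [← Finset.sum_add_distrib, ← Finset.sum_add_distrib]
        exact Finset.sum_congr rfl fun i _ => by ring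
      have hsq : (z a - h * b) ^ 2 ≤ h ^ 2 := sq_le_sq' (abs_le.1 hb1).1 (abs_le.1 hb1).2
      have := mul_le_mul_of_nonneg_right hsq
        (Finset.sum_nonneg fun i _ => sq_nonneg (X i a) : 0 ≤ ∑ i ∈ G, X i a ^ 2)
      rw [hexp, mul_add]
      linarith

end Net
end RandomPolytope

namespace RandomPolytope

/-! ### From single vectors to all vectors. -/

section Approximation

variable {N n : ℕ}

/-- Long rows are discarded; among the others, the rounding bound and Chebyshev counting leave few
rows whose product moves by `c` or more. The point `k` depends on `Γ`. -/
lemma exists_lattice_ncard_le (Γ : Fin N → Fin n → ℝ) (z : Fin n → ℝ) {h c A : ℝ} (hh : 0 < h)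
    (hc : 0 < c) (hA : 0 ≤ A) :
    ∃ k : Fin n → ℤ, (∀ j, |z j - h * k j| ≤ h) ∧
      ({i | 2 * c ≤ |∑ j, h * k j * Γ i j|}.ncard : ℝ) ≤
        ({i | c ≤ |∑ j, z j * Γ i j|}.ncard : ℝ) + ({i | A * n ≤ ∑ j, Γ i j ^ 2}.ncard : ℝ)
          + h ^ 2 * (N * (A * n)) / c ^ 2 := by
  classical
  set G : Finset (Fin N) := Finset.univ.filter fun i => ∑ j, Γ i j ^ 2 < A * n with hG
  obtain ⟨k, hk, hsum⟩ := exists_lattice_rounding G Γ z hh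
  refine ⟨k, hk, ?_⟩
  set R : Finset (Fin N) := G.filter fun i => c ≤ |∑ j, Γ i j * (z j - h * k j)| with hR
  have hsub : {i | 2 * c ≤ |∑ j, h * k j * Γ i j|} ⊆
      ({i | c ≤ |∑ j, z j * Γ i j|} ∪ {i | A * n ≤ ∑ j, Γ i j ^ 2}) ∪ (R : Set (Fin N)) := by
    intro i hi
    by_contra hcon
    simp only [Set.mem_union, not_or, Set.mem_ofPred_eq, not_le] at hcon hi
    obtain ⟨⟨h1, h2⟩, h3⟩ := hcon
    have h4 : |∑ j, Γ i j * (z j - h * k j)| < c := by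
      by_contra h5
      refine h3 ?_
      rw [hR, Finset.coe_filter]
      exact ⟨Finset.mem_filter.2 ⟨Finset.mem_univ _, h2⟩, not_lt.1 h5⟩
    have h5 : ∑ j, h * k j * Γ i j = ∑ j, z j * Γ i j - ∑ j, Γ i j * (z j - h * k j) := by
      rw [← Finset.sum_sub_distrib]
      exact Finset.sum_congr rfl fun j _ => by ring
    rw [h5] at hi
    have := abs_sub (∑ j, z j * Γ i j) (∑ j, Γ i j * (z j - h * k j))
    linarith
  have hcard : ({i | 2 * c ≤ |∑ j, h * k j * Γ i j|}.ncard : ℝ) ≤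
      ({i | c ≤ |∑ j, z j * Γ i j|}.ncard : ℝ) + ({i | A * n ≤ ∑ j, Γ i j ^ 2}.ncard : ℝ)
        + R.card := by
    have h1 := Set.ncard_le_ncard hsub (Set.toFinite _)
    have h2 := Set.ncard_union_le
      ({i | c ≤ |∑ j, z j * Γ i j|} ∪ {i | A * n ≤ ∑ j, Γ i j ^ 2}) (R : Set (Fin N))
    have h3 := Set.ncard_union_le {i | c ≤ |∑ j, z j * Γ i j|} {i | A * n ≤ ∑ j, Γ i j ^ 2}
    rw [Set.ncard_coe_finset] at h2
    exact_mod_cast (h1.trans h2).trans (by omega)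
  have hRc : (R.card : ℝ) * c ^ 2 ≤ h ^ 2 * (N * (A * n)) := by
    calc (R.card : ℝ) * c ^ 2 = ∑ i ∈ R, c ^ 2 := by simp
      _ ≤ ∑ i ∈ R, (∑ j, Γ i j * (z j - h * k j)) ^ 2 := by
        refine Finset.sum_le_sum fun i hi => ?_
        rw [← sq_abs (∑ j, Γ i j * (z j - h * k j))]
        exact pow_le_pow_left₀ hc.le (Finset.mem_filter.1 hi).2 2
      _ ≤ ∑ i ∈ G, (∑ j, Γ i j * (z j - h * k j)) ^ 2 :=
        Finset.sum_le_sum_of_subset_of_nonneg (Finset.filter_subset _ _) fun _ _ _ => sq_nonneg _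
      _ ≤ h ^ 2 * ∑ j, ∑ i ∈ G, Γ i j ^ 2 := hsum
      _ = h ^ 2 * ∑ i ∈ G, ∑ j, Γ i j ^ 2 := by rw [Finset.sum_comm]
      _ ≤ h ^ 2 * (N * (A * n)) := by
        refine mul_le_mul_of_nonneg_left ?_ (sq_nonneg h)
        calc ∑ i ∈ G, ∑ j, Γ i j ^ 2 ≤ ∑ _i ∈ G, A * n :=
              Finset.sum_le_sum fun i hi => (Finset.mem_filter.1 hi).2.le
          _ = G.card * (A * n) := by simp
          _ ≤ N * (A * n) := by
            refine mul_le_mul_of_nonneg_right ?_ (by positivity)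
            exact_mod_cast (Finset.card_le_univ G).trans_eq (Fintype.card_fin N)
  rw [← le_div_iff₀ (by positivity)] at hRc
  linarith

/-- Uniform control of the number of large inner products, over all vectors at once, deduced from
tail bounds for single vectors. -/
lemma exists_bad_set {ν : Measure (Fin n → ℝ)} [IsProbabilityMeasure ν] (hn : 0 < n)
    {u c T : ℝ} (hu : 0 < u) (hc : 0 < c) (hr : c * u / 4 ≤ 1)
    (hT : T * (c * u / 4) ^ 2 ≤ 1 / 16)
    (hnet : n * (1 + Real.log (8 / (c * u / 4))) ≤ N * u / 5)
    (hrow : ν.real {x | 8 / u * n ≤ ∑ j, x j ^ 2} ≤ u / 8)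
    (htail : ∀ y : Fin n → ℝ, ∑ j, y j ^ 2 ≤ 4 →
      (∃ v : Fin n → ℝ, (∀ j, |v j| ≤ 1) ∧ ∑ j, v j ^ 2 ≤ T ∧ 1 / 4 ≤ ∑ j, v j * y j) →
      4 * u ≤ ν.real {x | 2 * c ≤ |∑ j, y j * x j|}) :
    ∃ B : Set (Fin N → Fin n → ℝ), MeasurableSet B ∧
      (Measure.pi fun _ : Fin N => ν).real B ≤ 2 * Real.exp (-(N * u / 5)) ∧
      ∀ Γ ∉ B, ∀ z : Fin n → ℝ, ∑ j, z j ^ 2 ≤ 1 →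
        (∃ v : Fin n → ℝ, (∀ j, |v j| ≤ 1) ∧ ∑ j, v j ^ 2 ≤ T ∧ 1 / 2 ≤ ∑ j, v j * z j) →
        N * u ≤ ({i | c ≤ |∑ j, z j * Γ i j|}.ncard : ℝ) := by
  classical
  -- With `A = 8 / u`, this mesh spoils at most `r ^ 2 * N * (8 / u) / c ^ 2 = N * u / 2` rows.
  set r := c * u / 4 with hrdef
  have hr0 : 0 < r := by positivity
  have hn' : (0 : ℝ) < n := Nat.cast_pos.2 hn
  set h := r / √n with hh
  have hh0 : 0 < h := by positivity
  have hhn : h ^ 2 * n = r ^ 2 := by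
    rw [hh, div_pow, Real.sq_sqrt hn'.le]; field_simp
  -- A rounded vector has norm at most `2`, so `‖k‖₁ ≤ √n * 2 / h = 2 * n / r`. The parameter `r /
  -- 2` makes the exponential prefactor `exp n`.
  obtain ⟨F, hF, hFcard⟩ := exists_finset_lattice n (2 * n / r) (half_pos hr0)
  set tailSet : (Fin n → ℤ) → Set (Fin n → ℝ) := fun k =>
    {x | 2 * c ≤ |∑ j, h * k j * x j|} with htailSet
  set longSet : Set (Fin n → ℝ) := {x | 8 / u * n ≤ ∑ j, x j ^ 2} with hlongSet
  have htm : ∀ k, MeasurableSet (tailSet k) := fun k =>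
    measurableSet_le measurable_const (by fun_prop)
  have hlm : MeasurableSet longSet := measurableSet_le measurable_const (by fun_prop)
  set F' := F.filter fun k => 4 * u ≤ ν.real (tailSet k) with hF'
  set B₁ : Set (Fin N → Fin n → ℝ) :=
    ⋃ k ∈ F', {Γ | ({i | Γ i ∈ tailSet k}.ncard : ℝ) ≤ 2 * (N * u)} with hB₁
  set B₂ : Set (Fin N → Fin n → ℝ) := {Γ | N * u / 2 ≤ ({i | Γ i ∈ longSet}.ncard : ℝ)} with hB₂
  have hB₁m : MeasurableSet B₁ := Finset.measurableSet_biUnion _ fun k _ =>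
    measurableSet_le (measurable_ncard (htm k)) measurable_const
  have hB₂m : MeasurableSet B₂ := measurableSet_le measurable_const (measurable_ncard hlm)
  -- Each net point fails with probability at most `exp (-2Nu/5)`; half of the exponent pays for the
  -- net.
  have hp₁ : (Measure.pi fun _ : Fin N => ν).real B₁ ≤ Real.exp (-(N * u / 5)) := by
    have hcard : (F'.card : ℝ) ≤ Real.exp (N * u / 5) := by
      calc (F'.card : ℝ) ≤ F.card := by exact_mod_cast Finset.card_filter_le _ _
        _ ≤ Real.exp (r / 2 * (2 * n / r)) * (2 / (1 - Real.exp (-(r / 2)))) ^ n := hFcard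
        _ ≤ Real.exp n * (8 / r) ^ n := by
          have e : r / 2 * (2 * n / r) = n := by field_simp
          rw [e]
          refine mul_le_mul_of_nonneg_left (pow_le_pow_left₀ ?_
            (two_div_one_sub_exp_neg_le hr0 hr) n) (Real.exp_pos _).le
          refine div_nonneg (by norm_num) (sub_nonneg.2 (Real.exp_le_one_iff.2 ?_))
          linarith
        _ = Real.exp (n * (1 + Real.log (8 / r))) := by
          rw [mul_add, mul_one, Real.exp_add, Real.exp_nat_mul, Real.exp_log (by positivity)]
        _ ≤ _ := Real.exp_le_exp.2 hnet
    calc (Measure.pi fun _ : Fin N => ν).real B₁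
        ≤ ∑ k ∈ F', (Measure.pi fun _ : Fin N => ν).real
            {Γ | ({i | Γ i ∈ tailSet k}.ncard : ℝ) ≤ 2 * (N * u)} :=
          measureReal_biUnion_finset_le _ _
      _ ≤ ∑ _k ∈ F', Real.exp (2 * (N * u) - 3 / 5 * (N * (4 * u))) :=
          Finset.sum_le_sum fun k hk =>
            measureReal_ncard_le_le (htm k) (Finset.mem_filter.1 hk).2 _
      _ = F'.card * Real.exp (-(2 * (N * u) / 5)) := by
          rw [Finset.sum_const, nsmul_eq_mul]; ring_nf
      _ ≤ Real.exp (N * u / 5) * Real.exp (-(2 * (N * u) / 5)) :=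
          mul_le_mul_of_nonneg_right hcard (Real.exp_pos _).le
      _ = _ := by rw [← Real.exp_add]; ring_nf
  have hp₂ : (Measure.pi fun _ : Fin N => ν).real B₂ ≤ Real.exp (-(N * u / 5)) := by
    refine (measureReal_le_ncard_le hlm hrow _).trans (Real.exp_le_exp.2 ?_)
    have : 0 ≤ N * u := by positivity
    linarith
  refine ⟨B₁ ∪ B₂, hB₁m.union hB₂m, ?_, ?_⟩
  · refine (measureReal_union_le _ _).trans ?_
    linarith
  rintro Γ hΓ z hz ⟨v, hv1, hvT, hvz⟩
  rw [Set.mem_union, not_or] at hΓ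
  obtain ⟨k, hk, hcount⟩ := exists_lattice_ncard_le Γ z hh0 hc (A := 8 / u) (by positivity)
  have hdist : ∑ j, (z j - h * k j) ^ 2 ≤ r ^ 2 := by
    calc ∑ j, (z j - h * k j) ^ 2 ≤ ∑ _j : Fin n, h ^ 2 :=
          Finset.sum_le_sum fun j _ => sq_le_sq' (abs_le.1 (hk j)).1 (abs_le.1 (hk j)).2
      _ = r ^ 2 := by simp [← hhn, mul_comm]
  have hy4 : ∑ j, (h * k j) ^ 2 ≤ 4 := by
    calc ∑ j, (h * k j) ^ 2 ≤ ∑ j, (2 * z j ^ 2 + 2 * (z j - h * k j) ^ 2) :=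
          Finset.sum_le_sum fun j _ => by nlinarith [sq_nonneg (2 * z j - h * k j)]
      _ = 2 * ∑ j, z j ^ 2 + 2 * ∑ j, (z j - h * k j) ^ 2 := by
          rw [Finset.sum_add_distrib, Finset.mul_sum, Finset.mul_sum]
      _ ≤ 4 := by nlinarith
  have hkF : k ∈ F := by
    rw [hF]
    have h1 : (∑ j, |(k j : ℝ)|) ^ 2 ≤ n * ∑ j, (k j : ℝ) ^ 2 := by
      simpa using sq_sum_le_card_mul_sum_sq (s := Finset.univ) (f := fun j => |(k j : ℝ)|)
    have h2 : h ^ 2 * ∑ j, (k j : ℝ) ^ 2 ≤ 4 := by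
      rw [Finset.mul_sum]; simpa only [mul_pow] using hy4
    refine (sq_le_sq₀ (Finset.sum_nonneg fun _ _ => abs_nonneg _) (by positivity)).1 ?_
    rw [div_pow, le_div_iff₀ (by positivity)]
    calc (∑ j, |(k j : ℝ)|) ^ 2 * r ^ 2 ≤ (n * ∑ j, (k j : ℝ) ^ 2) * r ^ 2 :=
          mul_le_mul_of_nonneg_right h1 (sq_nonneg r)
      _ = n ^ 2 * (h ^ 2 * ∑ j, (k j : ℝ) ^ 2) := by rw [← hhn]; ring
      _ ≤ n ^ 2 * 4 := mul_le_mul_of_nonneg_left h2 (by positivity)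
      _ = _ := by ring
  -- Rounding changes the pairing with `v` by at most `√T * r ≤ 1 / 4`.
  have hvy : 1 / 4 ≤ ∑ j, v j * (h * k j) := by
    have h1 : (∑ j, v j * (z j - h * k j)) ^ 2 ≤ (1 / 4) ^ 2 := by
      refine (Finset.sum_mul_sq_le_sq_mul_sq _ _ _).trans ?_
      calc _ ≤ T * r ^ 2 := mul_le_mul hvT hdist (Finset.sum_nonneg fun _ _ => sq_nonneg _)
              ((Finset.sum_nonneg fun _ _ => sq_nonneg _).trans hvT)
        _ ≤ _ := by norm_num; linarith
    have h2 := (abs_le_of_sq_le_sq' h1 (by norm_num)).2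
    have h3 : ∑ j, v j * (z j - h * k j) = ∑ j, v j * z j - ∑ j, v j * (h * k j) := by
      rw [← Finset.sum_sub_distrib]
      exact Finset.sum_congr rfl fun j _ => by ring
    linarith
  have hkF' : k ∈ F' :=
    Finset.mem_filter.2 ⟨hkF, htail (fun j => h * k j) hy4 ⟨v, hv1, hvT, hvy⟩⟩
  -- The balance: `2Nu` good rows at the net point, less `Nu/2` long rows and `Nu/2` spoiled ones.
  have h1 : 2 * (N * u) < ({i | Γ i ∈ tailSet k}.ncard : ℝ) := by
    by_contra hcon
    exact hΓ.1 (Set.mem_biUnion hkF' (not_lt.1 hcon))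
  have h2 : ({i | Γ i ∈ longSet}.ncard : ℝ) < N * u / 2 := not_le.1 hΓ.2
  have h3 : h ^ 2 * (N * (8 / u * n)) / c ^ 2 = N * u / 2 := by
    calc h ^ 2 * (N * (8 / u * n)) / c ^ 2 = (h ^ 2 * n) * (N * (8 / u)) / c ^ 2 := by ring
      _ = N * u / 2 := by rw [hhn, hrdef]; field_simp; ring
  rw [h3] at hcount
  simp only [htailSet, hlongSet, Set.mem_ofPred_eq] at h1 h2
  linarith

end Approximation
end RandomPolytope

namespace RandomPolytope

/-! ### The law of the matrix and its rows. -/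

section Law

lemma isSymmUnitLaw_map {Ω : Type*} [MeasurableSpace Ω] {P : Measure Ω} [IsProbabilityMeasure P]
    {ξ : Ω → ℝ} {κ δ : ℝ} (hs : IsSymmetric ξ P) (hv : variance ξ P = 1)
    (hb : SmallBall ξ P κ δ) : IsSymmUnitLaw (P.map ξ) κ δ := by
  have hξ : AEMeasurable ξ P := hs.aemeasurable_fst
  have hmap : (P.map ξ).map (fun x => -x) = P.map ξ := by
    rw [AEMeasurable.map_map_of_aemeasurable (by fun_prop) hξ]
    exact hs.map_eq.symm
  -- Outside `L²` the real-valued variance is `0`, so variance `1` forces square integrability.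
  have hL : MemLp ξ 2 P :=
    memLp_two_of_variance_ne_zero hξ.aestronglyMeasurable (by rw [hv]; exact one_ne_zero)
  have h0 : ∫ ω, ξ ω ∂P = 0 := by
    have := integral_odd hmap (f := fun x => x) (fun _ => rfl)
    rwa [integral_map hξ (by fun_prop)] at this
  refine ⟨hmap, ?_, ?_, ?_⟩
  · rw [integrable_map_measure (by fun_prop) hξ]
    exact hL.integrable_sq
  · rw [integral_map hξ (by fun_prop), ← hv, variance_of_integral_eq_zero hξ h0]
  · rw [map_measureReal_apply_of_aemeasurable hξ
      (measurableSet_le measurable_const (by fun_prop))]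
    exact hb

lemma HasIIDEntries.map_eq {Ω Ω' : Type*} [MeasurableSpace Ω] [MeasurableSpace Ω'] {N n : ℕ}
    {Γ : Ω → Matrix (Fin N) (Fin n) ℝ} {P : Measure Ω} [IsProbabilityMeasure P]
    {ξ : Ω' → ℝ} {P' : Measure Ω'} [IsProbabilityMeasure P'] (h : HasIIDEntries Γ P ξ P')
    (hξ : AEMeasurable ξ P') :
    P.map (fun ω i j => Γ ω i j)
      = Measure.pi fun _ : Fin N => Measure.pi fun _ : Fin n => P'.map ξ := by
  have : IsProbabilityMeasure (P'.map ξ) := Measure.isProbabilityMeasure_map hξ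
  have hm : ∀ p : Fin N × Fin n, AEMeasurable (fun ω => Γ ω p.1 p.2) P :=
    fun p => (h.identDistrib p.1 p.2).aemeasurable_fst
  have h1 := h.indep.map_fun_eq_pi_map hm
  have h2 : ∀ p : Fin N × Fin n, P.map (fun ω => Γ ω p.1 p.2) = P'.map ξ :=
    fun p => (h.identDistrib p.1 p.2).map_eq
  simp only [h2] at h1
  have h3 := Measure.infinitePi_map_curry (fun (_ : Fin N) (_ : Fin n) => P'.map ξ)
  simp only [Measure.infinitePi_eq_pi] at h3
  rw [← h3, ← h1, AEMeasurable.map_map_of_aemeasurable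
    (MeasurableEquiv.measurable _).aemeasurable (aemeasurable_pi_lambda _ hm)]
  rfl

variable {μ : Measure ℝ} [IsProbabilityMeasure μ] {κ δ : ℝ} {n : ℕ}

lemma IsSymmUnitLaw.measureReal_sum_sq_le (h : IsSymmUnitLaw μ κ δ) (hn : 0 < n) {A : ℝ}
    (hA : 0 < A) :
    (Measure.pi fun _ : Fin n => μ).real {x | A * n ≤ ∑ j, x j ^ 2} ≤ 1 / A := by
  have hn' : (0 : ℝ) < n := Nat.cast_pos.2 hn
  have hi : ∀ j : Fin n, Integrable (fun x : Fin n → ℝ => x j ^ 2) (Measure.pi fun _ => μ) :=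
    fun j => integrable_comp_eval (μ := fun _ : Fin n => μ) (i := j) h.integrable_sq
  have h1 : ∫ x : Fin n → ℝ, ∑ j, x j ^ 2 ∂(Measure.pi fun _ => μ) = n := by
    rw [integral_finsetSum _ fun j _ => hi j]
    have : ∀ j : Fin n, ∫ x : Fin n → ℝ, x j ^ 2 ∂(Measure.pi fun _ => μ) = 1 := fun j => by
      rw [← h.integral_sq]
      exact integral_comp_eval (μ := fun _ : Fin n => μ) (i := j) (f := fun y : ℝ => y ^ 2)
        (by fun_prop)
    simp [this]
  have h2 := mul_meas_ge_le_integral_of_nonneg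
    (Filter.Eventually.of_forall fun x => Finset.sum_nonneg fun j _ => sq_nonneg (x j))
    (integrable_finsetSum Finset.univ fun j _ => hi j) (A * n)
  rw [h1] at h2
  rw [le_div_iff₀ hA]
  nlinarith

/-- The tilt is taken along `η v`: its mean shift is at least `M`, and its cost exponent is at most
`η ^ 2 * T`. -/
lemma IsSymmUnitLaw.le_measureReal_abs_sum (h : IsSymmUnitLaw μ κ δ) (hκ : 0 < κ) (hδ : 0 < δ)
    {η M T : ℝ} (hη0 : 0 < η) (hη1 : η ≤ 1) (hM : M = η * (κ * δ) / 4)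
    {y v : Fin n → ℝ} (hy : ∑ j, y j ^ 2 ≤ 4) (hv : ∀ j, |v j| ≤ 1) (hvT : ∑ j, v j ^ 2 ≤ T)
    (hvy : 1 / 4 ≤ ∑ j, v j * y j) :
    (M ^ 2 / (4 * (M ^ 2 + 4))) ^ 2 * Real.exp (-(η ^ 2 * T))
      ≤ (Measure.pi fun _ : Fin n => μ).real {x | M / 2 ≤ |∑ j, y j * x j|} := by
  set q := ∫ x, truncSign κ x * x ∂μ with hq
  have hqle : κ * δ ≤ q := h.le_integral_truncSign_mul hκ
  have hM0 : 0 < M := by rw [hM]; positivity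
  set M' := ∑ j, y j * (η * v j * q) with hM'
  have hMM' : M ≤ M' := by
    have e : M' = η * (q * ∑ j, v j * y j) := by
      rw [hM', Finset.mul_sum, Finset.mul_sum]
      exact Finset.sum_congr rfl fun j _ => by ring
    rw [e, hM, mul_div_assoc]
    refine mul_le_mul_of_nonneg_left ?_ hη0.le
    calc κ * δ / 4 = κ * δ * (1 / 4) := by ring
      _ ≤ _ := mul_le_mul hqle hvy (by norm_num) ((by positivity : 0 ≤ κ * δ).trans hqle)
  have hc : ∀ j, |η * v j| ≤ 1 := fun j => by
    rw [abs_mul, abs_of_pos hη0]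
    exact mul_le_one₀ hη1 (abs_nonneg _) (hv j)
  have hG : ∑ j, (η * v j) ^ 2 ≤ η ^ 2 * T := by
    simp_rw [mul_pow]
    rw [← Finset.mul_sum]
    exact mul_le_mul_of_nonneg_left hvT (sq_nonneg η)
  refine le_trans ?_ ((h.le_measureReal_sum hκ hc hM'.symm (hM0.trans_le hMM') hG hy).trans
    (measureReal_mono fun x hx => ?_))
  · refine mul_le_mul_of_nonneg_right (pow_le_pow_left₀ (by positivity) ?_ 2) (Real.exp_pos _).le
    have hsq : M ^ 2 ≤ M' ^ 2 := pow_le_pow_left₀ hM0.le hMM' 2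
    rw [div_le_div_iff₀ (by positivity) (by positivity)]
    nlinarith
  · have hx' : M' / 2 ≤ ∑ j, y j * x j := hx
    exact (by linarith : M / 2 ≤ ∑ j, y j * x j).trans (le_abs_self _)

end Law

/-! ### Polarity and the absolute convex hull. -/

section Geometry

variable {N n : ℕ}

lemma mem_body_iff {v : EuclideanSpace ℝ (Fin n)} (hT : 0 ≤ Real.log (Real.exp 1 * N / n)) :
    v ∈ body N n ↔ (∀ j, |v j| ≤ 1) ∧ ∑ j, v j ^ 2 ≤ Real.log (Real.exp 1 * N / n) := by
  rw [body, euclideanBall, smul_unitClosedBall_of_nonneg (Real.sqrt_nonneg _)]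
  refine and_congr Iff.rfl ?_
  rw [mem_closedBall_zero_iff, Real.le_sqrt (norm_nonneg _) hT, EuclideanSpace.real_norm_sq_eq]

lemma inner_eq_sum (x y : EuclideanSpace ℝ (Fin n)) : inner ℝ x y = ∑ j, x j * y j := by
  simp [PiLp.inner_apply, mul_comm]

lemma mem_dualBody_iff {z : EuclideanSpace ℝ (Fin n)} :
    z ∈ dualBody N n ↔ ∀ v ∈ body N n, |inner ℝ v z| ≤ 1 := Iff.rfl

lemma neg_mem_body {v : EuclideanSpace ℝ (Fin n)} (hT : 0 ≤ Real.log (Real.exp 1 * N / n))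
    (hv : v ∈ body N n) : -v ∈ body N n := by
  rw [mem_body_iff hT] at hv ⊢
  simpa using hv

lemma norm_le_of_mem_body {v : EuclideanSpace ℝ (Fin n)}
    (hT : 0 ≤ Real.log (Real.exp 1 * N / n)) (hv : v ∈ body N n) :
    ‖v‖ ≤ √(Real.log (Real.exp 1 * N / n)) := by
  rw [Real.le_sqrt (norm_nonneg _) hT, EuclideanSpace.real_norm_sq_eq]
  exact ((mem_body_iff hT).1 hv).2

/-- A logarithm of at least `1` puts the Euclidean unit ball inside `L`. -/
lemma exists_mem_body_inner_eq_norm (hT : 1 ≤ Real.log (Real.exp 1 * N / n))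
    (z : EuclideanSpace ℝ (Fin n)) : ∃ v ∈ body N n, inner ℝ v z = ‖z‖ := by
  have hT0 : 0 ≤ Real.log (Real.exp 1 * N / n) := zero_le_one.trans hT
  by_cases hz : z = 0
  · exact ⟨0, (mem_body_iff hT0).2 (by simpa using hT0), by simp [hz]⟩
  · have hz' : 0 < ‖z‖ := norm_pos_iff.2 hz
    have h1 : ‖(‖z‖⁻¹ • z)‖ = 1 := norm_smul_inv_norm (𝕜 := ℝ) hz
    refine ⟨‖z‖⁻¹ • z, (mem_body_iff hT0).2 ⟨fun j => ?_, ?_⟩, ?_⟩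
    · have := PiLp.norm_apply_le (‖z‖⁻¹ • z) j
      rwa [h1] at this
    · rw [← EuclideanSpace.real_norm_sq_eq, h1]
      simpa using hT
    · rw [real_inner_smul_left, real_inner_self_eq_norm_sq]
      field_simp

lemma norm_le_one_of_mem_frontier (hT : 1 ≤ Real.log (Real.exp 1 * N / n))
    {z : EuclideanSpace ℝ (Fin n)} (hz : z ∈ frontier (dualBody N n)) : ‖z‖ ≤ 1 := by
  have hsub : dualBody N n ⊆ Metric.closedBall 0 1 := fun z hz => by
    obtain ⟨v, hv, he⟩ := exists_mem_body_inner_eq_norm hT z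
    rw [mem_closedBall_zero_iff, ← he]
    exact (le_abs_self _).trans (mem_dualBody_iff.1 hz v hv)
  simpa using closure_minimal hsub Metric.isClosed_closedBall (frontier_subset_closure hz)

/-- Were all pairings below `1/2`, boundedness of `L` would make `z` interior to the polar. Asking
for `1/2` rather than `1` leaves room for this perturbation. -/
lemma exists_mem_body_of_mem_frontier (hT : 0 ≤ Real.log (Real.exp 1 * N / n))
    {z : EuclideanSpace ℝ (Fin n)} (hz : z ∈ frontier (dualBody N n)) :
    ∃ v ∈ body N n, 1 / 2 ≤ inner ℝ v z := by
  by_contra! hcon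
  set t := √(Real.log (Real.exp 1 * N / n)) with ht
  have ht0 : 0 ≤ t := Real.sqrt_nonneg _
  refine hz.2 (mem_interior_iff_mem_nhds.2 (Filter.mem_of_superset
    (Metric.ball_mem_nhds z (by positivity : 0 < 1 / (2 * (1 + t)))) fun y hy => ?_))
  rw [mem_dualBody_iff]
  intro v hv
  have h1 : |inner ℝ v z| ≤ 1 / 2 := by
    refine abs_le.2 ⟨?_, (hcon v hv).le⟩
    have := hcon (-v) (neg_mem_body hT hv)
    rw [inner_neg_left] at this
    linarith
  have h2 : |inner ℝ v (y - z)| ≤ 1 / 2 := by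
    calc |inner ℝ v (y - z)| ≤ ‖v‖ * ‖y - z‖ := abs_real_inner_le_norm _ _
      _ ≤ (1 + t) * (1 / (2 * (1 + t))) := by
        refine mul_le_mul ?_ ?_ (norm_nonneg _) (by positivity)
        · linarith [norm_le_of_mem_body hT hv]
        · exact (mem_ball_iff_norm.1 hy).le
      _ = 1 / 2 := by field_simp
  calc |inner ℝ v y| = |inner ℝ v z + inner ℝ v (y - z)| := by
        rw [← inner_add_right]; congr 2; abel
    _ ≤ |inner ℝ v z| + |inner ℝ v (y - z)| := abs_add_le _ _
    _ ≤ 1 := by linarith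

/-- The inclusion of a multiple of the body in the absolute convex hull of finitely many points,
by duality. -/
lemma smul_body_subset_absConvexHull (hT : 1 ≤ Real.log (Real.exp 1 * N / n)) (hN : 0 < N)
    (X : Fin N → EuclideanSpace ℝ (Fin n)) {c : ℝ} (hc : 0 < c)
    (hX : ∀ z : EuclideanSpace ℝ (Fin n), ‖z‖ ≤ 1 → (∃ v ∈ body N n, 1 / 2 ≤ inner ℝ v z) →
      ∃ i, c ≤ |inner ℝ z (X i)|) :
    c • body N n ⊆ absConvexHull ℝ (Set.range X) := by
  have hT0 : 0 ≤ Real.log (Real.exp 1 * N / n) := zero_le_one.trans hT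
  rintro _ ⟨w, hw, rfl⟩
  by_contra hcon
  have hclosed : IsClosed (absConvexHull ℝ (Set.range X)) := by
    rw [← convexHull_union_neg_eq_absConvexHull]
    have hf : (Set.range X ∪ -Set.range X).Finite :=
      (Set.finite_range X).union (Set.finite_range X).neg
    exact (hf.isCompact_convexHull ℝ).isClosed
  obtain ⟨f, s, hfs, hsw⟩ :=
    geometric_hahn_banach_closed_point convex_absConvexHull hclosed hcon
  set z := (InnerProductSpace.toDual ℝ (EuclideanSpace ℝ (Fin n))).symm f with hz
  have hzf : ∀ x, inner ℝ z x = f x := fun x => InnerProductSpace.toDual_symm_apply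
  have hs : ∀ i, |inner ℝ z (X i)| < s := fun i => by
    have h1 := subset_absConvexHull (𝕜 := ℝ) (Set.mem_range_self (f := X) i)
    have h2 := hfs _ h1
    have h3 := hfs _ (balanced_absConvexHull.neg_mem_iff.2 h1)
    rw [map_neg] at h3
    rw [hzf, abs_lt]
    constructor <;> linarith
  have hs0 : 0 < s := (abs_nonneg _).trans_lt (hs ⟨0, hN⟩)
  set V : Set ℝ := (fun v => inner ℝ v z) '' body N n with hV
  have hbdd : BddAbove V := by
    refine ⟨√(Real.log (Real.exp 1 * N / n)) * ‖z‖, ?_⟩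
    rintro _ ⟨v, hv, rfl⟩
    exact (real_inner_le_norm _ _).trans
      (mul_le_mul_of_nonneg_right (norm_le_of_mem_body hT0 hv) (norm_nonneg _))
  set σ := sSup V with hσ
  have hwσ : inner ℝ w z ≤ σ := le_csSup hbdd ⟨w, hw, rfl⟩
  have hsw' : s < c * inner ℝ w z := by
    have : f (c • w) = c * inner ℝ w z := by
      rw [← hzf, inner_smul_right, real_inner_comm]
    rw [← this]; exact hsw
  have hσ0 : 0 < σ := (pos_of_mul_pos_right (hs0.trans hsw') hc.le).trans_le hwσ
  have hnorm : ‖z‖ ≤ σ := by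
    obtain ⟨v, hv, he⟩ := exists_mem_body_inner_eq_norm hT z
    rw [← he]
    exact le_csSup hbdd ⟨v, hv, rfl⟩
  -- Normalising by the support function of `L` makes the supremum of the pairings `1`. The row
  -- found gives `c σ ≤ |⟪z, X_i⟫| < s < c ⟪w, z⟫ ≤ c σ`.
  obtain ⟨i, hi⟩ := hX (σ⁻¹ • z) (by
      rw [norm_smul, Real.norm_eq_abs, abs_of_pos (inv_pos.2 hσ0), inv_mul_le_iff₀ hσ0, mul_one]
      exact hnorm) (by
      obtain ⟨_, ⟨v, hv, rfl⟩, hlt⟩ := exists_lt_of_lt_csSup (s := V) ⟨_, w, hw, rfl⟩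
        (half_lt_self hσ0)
      refine ⟨v, hv, ?_⟩
      rw [inner_smul_right, le_inv_mul_iff₀ hσ0]
      linarith)
  rw [real_inner_smul_left, abs_mul, abs_of_pos (inv_pos.2 hσ0), le_inv_mul_iff₀ hσ0] at hi
  have h1 := hs i
  have h2 := mul_le_mul_of_nonneg_left hwσ hc.le
  linarith

end Geometry
end RandomPolytope

/-! ### Choice of the aspect ratio. -/

namespace RandomPolytope

/-- The numerical conditions on the aspect ratio `x` that the argument needs hold for large `x`. -/
lemma exists_aspect_ratio {α c b : ℝ} (hα0 : 0 < α) (hα1 : α < 1) (hc : 0 < c) (hb : 0 < b) :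
    ∃ x₀ : ℝ, 1 ≤ x₀ ∧ ∀ x, x₀ ≤ x →
      4 * x ^ (-α) ≤ b * Real.exp (-(α / 2 * (1 + Real.log x))) ∧
      c * x ^ (-α) / 4 ≤ 1 ∧
      (1 + Real.log x) * (c * x ^ (-α) / 4) ^ 2 ≤ 1 / 16 ∧
      1 + Real.log (8 / (c * x ^ (-α) / 4)) ≤ x * x ^ (-α) / 5 := by
  -- The gap between `x ^ (-α)` and the tilting cost `x ^ (-(α / 2))` absorbs all constants.
  have e1 : ∀ᶠ x : ℝ in Filter.atTop, x ^ (-(α / 2)) ≤ b * Real.exp (-(α / 2)) / 4 :=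
    (tendsto_rpow_neg_atTop (half_pos hα0)).eventually_le_const (by positivity)
  have e2 : ∀ᶠ x : ℝ in Filter.atTop, x ^ (-α) ≤ 4 / c :=
    (tendsto_rpow_neg_atTop hα0).eventually_le_const (by positivity)
  have e2' : ∀ᶠ x : ℝ in Filter.atTop, x ^ (-α) ≤ 1 / c ^ 2 / 2 :=
    (tendsto_rpow_neg_atTop hα0).eventually_le_const (by positivity)
  have e3 : ∀ᶠ x : ℝ in Filter.atTop, ‖Real.log x‖ ≤ 1 * ‖x ^ α‖ :=
    (isLittleO_log_rpow_atTop hα0).bound one_pos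
  have e4 : ∀ᶠ x : ℝ in Filter.atTop, ‖Real.log x‖ ≤ 1 / 10 * ‖x ^ (1 - α)‖ :=
    (isLittleO_log_rpow_atTop (by linarith)).bound (by norm_num)
  have e5 : ∀ᶠ x : ℝ in Filter.atTop, 10 * (1 + Real.log (32 / c)) ≤ x ^ (1 - α) :=
    (tendsto_rpow_atTop (by linarith)).eventually_ge_atTop _
  obtain ⟨x₀, hx₀⟩ := Filter.eventually_atTop.1
    (e1.and (e2.and (e2'.and (e3.and (e4.and e5)))))
  refine ⟨max 1 x₀, le_max_left _ _, fun x hx => ?_⟩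
  obtain ⟨h1, h2, h2', h3, h4, h5⟩ := hx₀ x ((le_max_right _ _).trans hx)
  have hx1 : 1 ≤ x := (le_max_left _ _).trans hx
  have hx0 : 0 < x := by linarith
  have hlog : 0 ≤ Real.log x := Real.log_nonneg hx1
  have hu0 : 0 < x ^ (-α) := Real.rpow_pos_of_pos hx0 _
  have hxa : 1 ≤ x ^ α := Real.one_le_rpow hx1 hα0.le
  have hmul : x ^ α * x ^ (-α) = 1 := by
    rw [← Real.rpow_add hx0, add_neg_cancel, Real.rpow_zero]
  have hxx : x * x ^ (-α) = x ^ (1 - α) := by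
    rw [sub_eq_add_neg, Real.rpow_add hx0, Real.rpow_one]
  rw [Real.norm_of_nonneg hlog, Real.norm_of_nonneg (by positivity)] at h3 h4
  refine ⟨?_, ?_, ?_, ?_⟩
  · have hsq : x ^ (-α) = x ^ (-(α / 2)) * x ^ (-(α / 2)) := by
      rw [← Real.rpow_add hx0]; ring_nf
    have hexp : Real.exp (-(α / 2 * (1 + Real.log x))) = Real.exp (-(α / 2)) * x ^ (-(α / 2)) := by
      rw [Real.rpow_def_of_pos hx0, ← Real.exp_add]; ring_nf
    rw [hsq, hexp]
    have := mul_le_mul_of_nonneg_right h1 (Real.rpow_pos_of_pos hx0 (-(α / 2))).le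
    linarith
  · rw [le_div_iff₀ hc] at h2
    linarith
  · calc (1 + Real.log x) * (c * x ^ (-α) / 4) ^ 2
        ≤ (2 * x ^ α) * (c * x ^ (-α) / 4) ^ 2 :=
          mul_le_mul_of_nonneg_right (by linarith) (sq_nonneg _)
      _ = (x ^ α * x ^ (-α)) * (2 * c ^ 2 * x ^ (-α) / 16) := by ring
      _ ≤ 1 / 16 := by
        rw [hmul, one_mul]
        have : c ^ 2 * x ^ (-α) ≤ c ^ 2 * (1 / c ^ 2 / 2) :=
          mul_le_mul_of_nonneg_left h2' (sq_nonneg c)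
        have e : c ^ 2 * (1 / c ^ 2 / 2) = 1 / 2 := by field_simp
        linarith
  · have e : 8 / (c * x ^ (-α) / 4) = 32 / c * x ^ α := by
      rw [Real.rpow_neg hx0.le]; field_simp; norm_num
    rw [e, Real.log_mul (by positivity) (by positivity), Real.log_rpow hx0, hxx]
    nlinarith

end RandomPolytope

/-! ### Assembly of the theorem. -/

theorem theorem1p4 (κ δ α : ℝ) (hκ : 0 < κ) (hδ : 0 < δ) (hα0 : 0 < α) (hα1 : α < 1) :
    ∃ c₀ c₁ c₂ c₃ : ℝ, 0 < c₀ ∧ 0 < c₁ ∧ 0 < c₂ ∧ 0 < c₃ ∧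
      ∀ {Ω' : Type*} [MeasurableSpace Ω'] (P' : Measure Ω') [IsProbabilityMeasure P']
        (ξ : Ω' → ℝ),
        RandomPolytope.IsSymmetric ξ P' → variance ξ P' = 1 →
        RandomPolytope.SmallBall ξ P' κ δ →
      ∀ {Ω : Type*} [MeasurableSpace Ω] (P : Measure Ω) [IsProbabilityMeasure P]
        (N n : ℕ) (Γ : Ω → Matrix (Fin N) (Fin n) ℝ),
        RandomPolytope.HasIIDEntries Γ P ξ P' → 0 < n → c₁ * (n : ℝ) ≤ (N : ℝ) →
        1 - 2 * Real.exp (-(c₂ * (N : ℝ) ^ (1 - α) * (n : ℝ) ^ α)) ≤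
          P.real {ω |
            c₃ • RandomPolytope.body N n ⊆
              absConvexHull ℝ (Set.range (RandomPolytope.rowVec (Γ ω))) ∧
            ∀ z ∈ frontier (RandomPolytope.dualBody N n),
              (N : ℝ) ^ (1 - α) * (n : ℝ) ^ α ≤
                ({i : Fin N | c₀ ≤ |inner ℝ z (RandomPolytope.rowVec (Γ ω) i)|}.ncard : ℝ)} := by
  set η := √(α / 2) with hη
  have hη0 : 0 < η := Real.sqrt_pos.2 (by positivity)
  have hη1 : η ≤ 1 := Real.sqrt_le_one.2 (by linarith)
  have hηsq : η ^ 2 = α / 2 := Real.sq_sqrt (by positivity)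
  set M := η * (κ * δ) / 4 with hM
  have hM0 : 0 < M := by positivity
  have hc0 : 0 < M / 4 := by positivity
  obtain ⟨x₀, hx₀1, hx₀⟩ := RandomPolytope.exists_aspect_ratio hα0 hα1 hc0
    (b := (M ^ 2 / (4 * (M ^ 2 + 4))) ^ 2) (by positivity)
  -- The single-vector tail is at level `M / 2 = 2 * (M / 4)`; rounding loses half of it.
  refine ⟨M / 4, x₀, 1 / 5, M / 4, hc0, by linarith, by norm_num, hc0, ?_⟩
  intro Ω' _ P' _ ξ hsymm hvar hsb Ω _ P _ N n Γ hΓ hn hNn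
  have hlaw := RandomPolytope.isSymmUnitLaw_map hsymm hvar hsb
  have hξ : AEMeasurable ξ P' := hsymm.aemeasurable_fst
  have hμ : IsProbabilityMeasure (P'.map ξ) := Measure.isProbabilityMeasure_map hξ
  have hn' : (0 : ℝ) < n := Nat.cast_pos.2 hn
  have hNR : (0 : ℝ) < N := by nlinarith
  have hN : 0 < N := Nat.cast_pos.1 hNR
  set x : ℝ := N / n with hx
  have hxx₀ : x₀ ≤ x := (le_div_iff₀ hn').2 hNn
  have hx1 : 1 ≤ x := hx₀1.trans hxx₀
  have hx0 : 0 < x := by linarith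
  set u := x ^ (-α) with hu
  have hu0 : 0 < u := Real.rpow_pos_of_pos hx0 _
  obtain ⟨hn1, hn2, hn3, hn4⟩ := hx₀ x hxx₀
  have hTlog : Real.log (Real.exp 1 * N / n) = 1 + Real.log x := by
    rw [mul_div_assoc, Real.log_mul (Real.exp_ne_zero _) hx0.ne', Real.log_exp]
  have hT1 : 1 ≤ Real.log (Real.exp 1 * N / n) := by
    rw [hTlog]; linarith [Real.log_nonneg hx1]
  have hT0 : 0 ≤ Real.log (Real.exp 1 * N / n) := zero_le_one.trans hT1
  have hNu : (N : ℝ) ^ (1 - α) * (n : ℝ) ^ α = N * u := by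
    rw [hu, hx, Real.div_rpow hNR.le hn'.le, Real.rpow_neg hn'.le, div_inv_eq_mul, sub_eq_add_neg,
      Real.rpow_add hNR, Real.rpow_one]
    ring
  obtain ⟨B, hBm, hBp, hB⟩ := RandomPolytope.exists_bad_set (N := N)
    (ν := Measure.pi fun _ : Fin n => P'.map ξ) hn hu0 hc0 (T := 1 + Real.log x) hn2 hn3
    (by
      calc n * (1 + Real.log (8 / (M / 4 * u / 4))) ≤ n * (x * u / 5) :=
            mul_le_mul_of_nonneg_left hn4 hn'.le
        _ = N * u / 5 := by rw [hx]; field_simp)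
    ((hlaw.measureReal_sum_sq_le hn (by positivity : 0 < 8 / u)).trans_eq (by rw [one_div_div]))
    (by
      rintro y hy ⟨v, hv1, hvT, hvy⟩
      have h := hlaw.le_measureReal_abs_sum hκ hδ hη0 hη1 hM hy hv1 hvT hvy
      rw [hηsq] at h
      have e : M / 2 = 2 * (M / 4) := by ring
      rw [e] at h
      exact hn1.trans h)
  have hcount : ∀ ω, (fun i j => Γ ω i j) ∉ B → ∀ z : EuclideanSpace ℝ (Fin n), ‖z‖ ≤ 1 →
      (∃ v ∈ RandomPolytope.body N n, 1 / 2 ≤ inner ℝ v z) →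
      N * u ≤ ({i : Fin N | M / 4 ≤ |inner ℝ z (RandomPolytope.rowVec (Γ ω) i)|}.ncard : ℝ) := by
    rintro ω hω z hz ⟨v, hv, hvz⟩
    rw [RandomPolytope.mem_body_iff hT0, hTlog] at hv
    rw [RandomPolytope.inner_eq_sum] at hvz
    simp only [RandomPolytope.inner_eq_sum]
    refine hB _ hω (fun j => z j) ?_ ⟨fun j => v j, hv.1, hv.2, hvz⟩
    rw [← EuclideanSpace.real_norm_sq_eq]
    exact pow_le_one₀ (norm_nonneg _) hz
  have hmeas : AEMeasurable (fun ω i j => Γ ω i j) P :=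
    aemeasurable_pi_lambda _ fun i => aemeasurable_pi_lambda _ fun j =>
      (hΓ.identDistrib i j).aemeasurable_fst
  have hPB : P.real ((fun ω i j => Γ ω i j) ⁻¹' B) ≤ 2 * Real.exp (-(N * u / 5)) := by
    rw [← map_measureReal_apply_of_aemeasurable hmeas hBm, hΓ.map_eq hξ]
    exact hBp
  have hexp : -(1 / 5 * (N : ℝ) ^ (1 - α) * (n : ℝ) ^ α) = -(N * u / 5) := by
    rw [mul_assoc, hNu]; ring
  rw [hexp, hNu]
  set S : Set Ω := ((fun ω i j => Γ ω i j) ⁻¹' B)ᶜ with hS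
  -- `Γ` is only a.e. measurable, so subadditivity replaces the formula for complements.
  have hone : 1 ≤ P.real S + P.real ((fun ω i j => Γ ω i j) ⁻¹' B) := by
    have := measureReal_union_le (μ := P) S ((fun ω i j => Γ ω i j) ⁻¹' B)
    rwa [hS, Set.compl_union_self, probReal_univ, ← hS] at this
  refine le_trans (by linarith : _ ≤ P.real S) (measureReal_mono fun ω hω => ⟨?_, fun z hz => ?_⟩)
  · refine RandomPolytope.smul_body_subset_absConvexHull hT1 hN _ hc0 fun z hz hv => ?_
    have h1 := hcount ω hω z hz hv
    have h2 : 0 < {i : Fin N | M / 4 ≤ |inner ℝ z (RandomPolytope.rowVec (Γ ω) i)|}.ncard := by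
      have : 0 < N * u := by positivity
      exact_mod_cast this.trans_le h1
    exact (Set.ncard_pos).1 h2
  · exact hcount ω hω z (RandomPolytope.norm_le_one_of_mem_frontier hT1 hz)
      (RandomPolytope.exists_mem_body_of_mem_frontier hT0 hz)
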